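/- **Conventions.** A representation of a set $X$ is a surjective partial map $\delta_X:\subseteq\mathbb N^{\mathbb N}\to X$. A partial multi-valued function $f:\subseteq X\rightrightarrows Y$ between represented spaces assigns to $x\in X$ a set $f(x)\subseteq Y$, and $\mathrm{dom}(f)=\{x: f(x)\neq\emptyset\}$. A realizer $F\vdash f$ is a partial function $F:\subseteq\mathbb N^{\mathbb N}\to\mathbb N^{\mathbb N}$ with $\delta_Y F(p)\in f(\delta_X(p))$ for all $p$ with $\delta_X(p)\in\mathrm{dom}(f)$. We write $f\le_{W} g$ if there are computable $K,H:\subseteq\mathbb N^{\mathbb N}\to\mathbb N^{\mathbb N}$ such that $p\mapsto H\langle p,GK(p)\rangle$ realizes $f$ for every $G\vdash g$; $f\le_{sW}g$ if the same holds with $HGK$ instead; and $f\equiv_{sW}g$ if $f\le_{sW}g$ and $g\le_{sW}f$. For a represented space $X$, $\mathcal A_-(X)$ is the set of subsets $A\subseteq X$ that are closed in the final topology of $\delta_X$, a name of $A$ being a name of the characteristic function of $X\setminus A$, as a function from $X$ to Sierpiński space $\mathbb S=\{0,1\}$, in the canonical function space representation; here $\delta_{\mathbb S}(p)=0$ if $p$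 is the zero sequence and $\delta_{\mathbb S}(p)=1$ otherwise. If $X$ carries a Borel measure $\mu$, then $\mathsf{PC}_X:\subseteq\mathcal A_-(X)\rightrightarrows X$, $A\mapsto A$, has domain $\{A:\mu(A)>0\}$. Here $2^{\mathbb N}$ carries the uniform product measure, $\mathbb N\times 2^{\mathbb N}$ the product of the counting measure and the uniform measure, and $\mathbb R$ Lebesgue measure; $2^{\mathbb N}$ and $\mathbb N\times2^{\mathbb N}$ are regarded as subsets of $\mathbb N^{\mathbb N}$ (with $(k,x)$ identified with the sequence $k\,x(0)\,x(1)\dots$), represented by the identity, and $\mathbb R$ has the Cauchy representation. $\mathsf{WWKL}$ maps a binary tree $T\subseteq\{0,1\}^*$, given by its characteristic function, with $\mu([T])>0$ to the set $[T]\subseteq2^{\mathbb N}$ of its infinite paths. The discrete jump $f^\Delta$ of $f:\subseteq(X,\delta_X)\rightrightarrows(Y,\delta_Y)$ is the same multi-valued function with $\delta_X$ replaced by $\delta_X\circ\lim_\Delta$, where $\lim_\Delta\langle p_0,p_1,\dots\rangle=q$ if $p_i=q$ for all sufficiently large $i$ (and $\lim_\Delta$ is undefined if there is no such $q$). A multi-valued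 function $f$ on represented spaces is *Las Vegas computable with finitely many mind changes* if, with $R=\mathbb N\times2^{\mathbb N}$ and its measure $\mu$ above, there are computable $F_1,F_2:\subseteq\mathbb N^{\mathbb N}\to\mathbb N^{\mathbb N}$ such that for every $p$ with $\delta_X(p)\in\mathrm{dom}(f)$: $F_2\langle p,r\rangle$ is defined for all $r\in R$; the set $S_p=\{r\in R:\delta_{\mathbb S}F_2\langle p,r\rangle=0\}$ is non-empty with $\mu(S_p)\in(0,\infty]$; and $\delta_YF_1\langle p,r\rangle\in f(\delta_X(p))$ for all $r\in S_p$. **Theorem.** $$\mathsf{WWKL}^\Delta\equiv_{sW}\mathsf{PC}_{2^{\mathbb N}}^\Delta\equiv_{sW}\mathsf{PC}_{\mathbb R}\equiv_{sW}\mathsf{PC}_{\mathbb N\times2^{\mathbb N}}.$$ Hence, for every multi-valued function $f$ on represented spaces, $f$ is Las Vegas computable with finitely many mind changes if and only if $f\le_W\mathsf{WWKL}^\Delta$. -/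

import Mathlib

open MeasureTheory
open scoped ENNReal Topology

universe u v u' v'

namespace Weihrauch

/-! ### Baire space: prefixes, pairing, computable partial functions -/

/-- The prefix of length `n` of a sequence. -/
def pre (p : ℕ → ℕ) (n : ℕ) : List ℕ := (List.range n).map p

/-- The pairing `⟨p, q⟩` of two sequences: `p` on even and `q` on odd positions. -/
def pairSeq (p q : ℕ → ℕ) : ℕ → ℕ := fun n => if n % 2 = 0 then p (n / 2) else q (n / 2)

/-- The pairing `⟨k, p⟩ = k p` of a number with a sequence. -/
def consSeq (k : ℕ) (p : ℕ → ℕ) : ℕ → ℕ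
  | 0 => k
  | n + 1 => p n

/-- A partial function `F` on Baire space is computable if some computable function `φ` on finite
words, monotone for the prefix relation, produces arbitrarily long prefixes of `F p` from prefixes
of `p`, for every `p` in the domain of `F`. By monotonicity, every word `φ (pre p n)` is then
itself a prefix of `F p`. -/
def ComputableFun (F : (ℕ → ℕ) →. (ℕ → ℕ)) : Prop :=
  ∃ φ : List ℕ → List ℕ, Computable φ ∧ (∀ u v, u <+: v → φ u <+: φ v) ∧
    ∀ p, ∀ q ∈ F p, ∀ k, ∃ n, pre q k <+: φ (pre p n)

/-- `Applies p q r`: the partial continuous function `η_p` on Baire space coded by `p` (`p` is an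
associate in the sense of Kleene) is defined at `q` with value `r`. The value at `n` is read off
from the shortest prefix of `q` on which `p` gives an answer. -/
def Applies (p q r : ℕ → ℕ) : Prop :=
  ∀ n, ∃ m, p (Encodable.encode (n, pre q m)) = r n + 1 ∧
    ∀ m' < m, p (Encodable.encode (n, pre q m')) = 0

/-! ### Represented spaces -/

/-- A representation of `X`: a surjective partial function from Baire space to `X`, given by its
graph; `Names p x` says that `p` is in the domain and is mapped to `x`. -/
structure Representation (X : Type*) where
  Names : (ℕ → ℕ) → X → Prop
  unique : ∀ {p x y}, Names p x → Names p y → x = y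
  surj : ∀ x, ∃ p, Names p x

namespace Representation

variable {X : Type*}

/-- The final topology of a representation: `U` is open iff its preimage is open in the domain. -/
@[reducible] noncomputable def finalTopology (δ : Representation X) : TopologicalSpace X :=
  TopologicalSpace.coinduced (fun q : {q : ℕ → ℕ // ∃ x, δ.Names q x} => q.2.choose) inferInstance

/-- Sierpiński space `{0, 1}`: the zero sequence names `0`, all other sequences name `1`. -/
def sierpinski : Representation Bool where
  Names p b := b = false ↔ ∀ n, p n = 0
  unique := by
    intro p x y hx hy
    cases x <;> cases y <;> simp_all
  surj := by
    intro b
    cases b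
    · exact ⟨fun _ => 0, by simp⟩
    · exact ⟨fun _ => 1, by simp⟩

/-- `p` is a name of `f : X → Y` in the function space representation `[δ_X → δ_Y]`: the partial
continuous function coded by `p` realizes `f`. -/
def FunNames {Y : Type*} (δX : Representation X) (δY : Representation Y) (p : ℕ → ℕ)
    (f : X → Y) : Prop :=
  ∀ q x, δX.Names q x → ∃ r, Applies p q r ∧ δY.Names r (f x)

/-- The closed subsets of a represented space, closed for the final topology. -/
def Closeds (δ : Representation X) : Type _ := {A : Set X // IsClosed[δ.finalTopology] A}

/-- The characteristic function of the complement of `A`, with values in Sierpiński space. -/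
noncomputable def coChar (A : Set X) : X → Bool :=
  open Classical in fun x => if x ∈ A then false else true

theorem applies_unique {p q r s : ℕ → ℕ} (hr : Applies p q r) (hs : Applies p q s) : r = s := by
  funext n
  obtain ⟨m, h1, h2⟩ := hr n
  obtain ⟨k, h3, h4⟩ := hs n
  rcases lt_trichotomy m k with h | h | h
  · have := h4 m h; omega
  · subst h; omega
  · have := h2 k h; omega

theorem exists_prefix_of_isOpen {V : Set (ℕ → ℕ)} (hV : IsOpen V) {q : ℕ → ℕ} (hq : q ∈ V) :
    ∃ n, ∀ q', pre q' n = pre q n → q' ∈ V := by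
  rw [isOpen_pi_iff] at hV
  obtain ⟨I, u, hu, hs⟩ := hV q hq
  refine ⟨I.sup id + 1, fun q' h => hs ?_⟩
  intro i hi
  have hlt : i < I.sup id + 1 := Nat.lt_succ_of_le (Finset.le_sup (f := id) hi)
  have : q' i = q i := by
    simp only [pre, List.map_inj_left, List.mem_range] at h
    exact h i hlt
  rw [this]
  exact (hu i hi).2

/-- The negative representation of the closed subsets: a name of `A` is a name of the
characteristic function of the complement of `A` in `[δ → δ_𝕊]`. -/
noncomputable def negative (δ : Representation X) : Representation δ.Closeds where
  Names p A := FunNames δ sierpinski p (coChar A.1)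
  unique := by
    intro p A B hA hB
    apply Subtype.ext
    ext x
    obtain ⟨q, hq⟩ := δ.surj x
    obtain ⟨r, hr, hr'⟩ := hA q x hq
    obtain ⟨s, hs, hs'⟩ := hB q x hq
    obtain rfl := applies_unique hr hs
    have := sierpinski.unique hr' hs'
    simp only [coChar] at this
    by_cases h1 : x ∈ A.1 <;> by_cases h2 : x ∈ B.1 <;> simp_all
  surj := by
    classical
    intro A
    obtain ⟨A, hA⟩ := A
    have hU : IsOpen[δ.finalTopology] Aᶜ := (@isOpen_compl_iff _ _ δ.finalTopology).2 hA
    rw [finalTopology, isOpen_coinduced] at hU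
    obtain ⟨V, hV, hVU⟩ := isOpen_induced_iff.1 hU
    have key : ∀ q x, δ.Names q x → (q ∈ V ↔ x ∉ A) := by
      intro q x hq
      have h := Set.ext_iff.1 hVU ⟨q, x, hq⟩
      simp only [Set.mem_preimage, Set.mem_compl_iff] at h
      rw [h]
      have : (Exists.intro x hq : ∃ x, δ.Names q x).choose = x :=
        δ.unique (Exists.choose_spec (Exists.intro x hq : ∃ x, δ.Names q x)) hq
      rw [this]
    refine ⟨fun c => match (Encodable.decode c : Option (ℕ × List ℕ)) with
      | none => 0
      | some (n, u) => if u.length < n then 0 else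
          if ∀ q, pre q u.length = u → q ∈ V then 2 else 1, ?_⟩
    intro q x hq
    refine ⟨fun n => if ∀ q', pre q' n = pre q n → q' ∈ V then 1 else 0, ?_, ?_⟩
    · intro n
      refine ⟨n, ?_, ?_⟩
      · simp only [Encodable.encodek]
        have : (pre q n).length = n := by simp [pre]
        simp only [this, lt_irrefl, if_false]
        split_ifs <;> rfl
      · intro m hm
        simp only [Encodable.encodek]
        have : (pre q m).length = m := by simp [pre]
        simp [this, hm]
    · show coChar A x = false ↔ _
      have hk := key q x hq
      by_cases hx : x ∈ A
      · have hqV : q ∉ V := fun h => (hk.1 h) hx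
        simp only [coChar, hx, if_true, true_iff]
        intro n
        rw [if_neg]
        exact fun h => hqV (h q rfl)
      · obtain ⟨n, hn⟩ := exists_prefix_of_isOpen hV (hk.2 hx)
        simp only [coChar, hx, if_false, Bool.true_eq_false, false_iff, not_forall]
        exact ⟨n, by rw [if_pos hn]; exact one_ne_zero⟩

/-- `p = ⟨p₀, p₁, …⟩` is mapped to `q` by the discrete limit map: `pᵢ = q` for almost all `i`,
where `pᵢ(j) = p ⟨i, j⟩`. -/
def DiscreteLim (p q : ℕ → ℕ) : Prop := ∃ N, ∀ i, N ≤ i → ∀ j, p (Nat.pair i j) = q j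

/-- The discrete jump of a representation: its composition with the discrete limit map. -/
def discreteJump (δ : Representation X) : Representation X where
  Names p x := ∃ q, DiscreteLim p q ∧ δ.Names q x
  unique := by
    rintro p x y ⟨q, ⟨N, hN⟩, hx⟩ ⟨r, ⟨M, hM⟩, hy⟩
    have : q = r := by
      funext j
      rw [← hN (max N M) (le_max_left _ _) j, hM (max N M) (le_max_right _ _) j]
    subst this
    exact δ.unique hx hy
  surj := by
    intro x
    obtain ⟨q, hq⟩ := δ.surj x
    exact ⟨fun n => q (Nat.unpair n).2, q, ⟨0, by simp⟩, hq⟩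

/-- Binary sequences as elements of Baire space. -/
def bits (x : ℕ → Bool) : ℕ → ℕ := fun i => (x i).toNat

theorem bits_injective : Function.Injective bits := by
  intro x y h
  funext i
  have := congrFun h i
  simp only [bits] at this
  cases hx : x i <;> cases hy : y i <;> simp_all

/-- Cantor space, a binary sequence being named by itself. -/
def cantor : Representation (ℕ → Bool) where
  Names p x := p = bits x
  unique := by
    intro p x y hx hy
    exact bits_injective (hx.symm.trans hy)
  surj x := ⟨_, rfl⟩

/-- The embedding of `ℕ × 2^ℕ` into Baire space, `(k, x) ↦ k x(0) x(1) …`. -/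
def natBits (a : ℕ × (ℕ → Bool)) : ℕ → ℕ := consSeq a.1 (bits a.2)

theorem natBits_injective : Function.Injective natBits := by
  rintro ⟨n, x⟩ ⟨m, y⟩ h
  have h0 : n = m := congrFun h 0
  have h1 : x = y := bits_injective (funext fun i => congrFun h (i + 1))
  rw [h0, h1]

/-- The space `ℕ × 2^ℕ`, the pair `(k, x)` being named by the sequence `k x(0) x(1) …`. -/
def natCantor : Representation (ℕ × (ℕ → Bool)) where
  Names p a := p = natBits a
  unique := by
    intro p x y hx hy
    exact natBits_injective (hx.symm.trans hy)
  surj x := ⟨_, rfl⟩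

/-- The enumeration `⟨⟨a, b⟩, c⟩ ↦ (a - b) / (c + 1)` of the rational numbers. -/
def ratOf (n : ℕ) : ℚ :=
  ((n.unpair.1.unpair.1 : ℚ) - (n.unpair.1.unpair.2 : ℚ)) / ((n.unpair.2 : ℚ) + 1)

theorem ratOf_surjective : Function.Surjective ratOf := by
  intro q
  refine ⟨Nat.pair (Nat.pair q.num.toNat (-q.num).toNat) (q.den - 1), ?_⟩
  have h1 : ((q.num.toNat : ℚ) - ((-q.num).toNat : ℚ)) = q.num := by
    have : (q.num.toNat : ℤ) - ((-q.num).toNat : ℤ) = q.num := by omega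
    exact_mod_cast this
  have h2 : (((q.den - 1 : ℕ) : ℚ) + 1) = q.den := by
    have : q.den - 1 + 1 = q.den := Nat.sub_add_cancel q.pos
    exact_mod_cast this
  simp only [ratOf, Nat.unpair_pair]
  rw [h1, h2, Rat.num_div_den]

/-- The Cauchy representation of the real numbers: a name of `x` is a sequence of (codes of)
rational numbers that converges to `x` with error at most `2^(-n)` at position `n`. -/
noncomputable def real : Representation ℝ where
  Names p x := ∀ n, |(ratOf (p n) : ℝ) - x| ≤ (1 / 2) ^ n
  unique := by
    intro p x y hx hy
    by_contra hne
    have hpos : 0 < |x - y| / 2 := by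
      have := abs_pos.2 (sub_ne_zero.2 hne)
      positivity
    obtain ⟨n, hn⟩ := exists_pow_lt_of_lt_one hpos (by norm_num : (1 / 2 : ℝ) < 1)
    have h1 := hx n
    have h2 := hy n
    have h3 : |x - y| ≤ |(ratOf (p n) : ℝ) - x| + |(ratOf (p n) : ℝ) - y| := by
      have := abs_sub ((ratOf (p n) : ℝ) - y) ((ratOf (p n) : ℝ) - x)
      have e : ((ratOf (p n) : ℝ) - y) - ((ratOf (p n) : ℝ) - x) = x - y := by ring
      rw [e] at this
      linarith
    linarith
  surj := by
    intro x
    have : ∀ n : ℕ, ∃ k, |(ratOf k : ℝ) - x| ≤ (1 / 2) ^ n := by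
      intro n
      have hpos : (0 : ℝ) < (1 / 2) ^ n := by positivity
      obtain ⟨q, hq1, hq2⟩ := exists_rat_btwn (show x < x + (1 / 2) ^ n by linarith)
      obtain ⟨k, rfl⟩ := ratOf_surjective q
      refine ⟨k, ?_⟩
      rw [abs_le]
      constructor <;> linarith
    choose p hp using this
    exact ⟨p, hp⟩

end Representation

/-- Binary trees: sets of finite binary words closed under prefixes. -/
def BinTree : Type := {T : Set (List Bool) // ∀ u v, u <+: v → v ∈ T → u ∈ T}

/-- The set `[T]` of infinite paths of a binary tree. -/
def BinTree.paths (T : BinTree) : Set (ℕ → Bool) := {x | ∀ n, (List.range n).map x ∈ T.1}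

/-- Binary trees represented by their characteristic functions. -/
noncomputable def Representation.tree : Representation BinTree where
  Names p T := ∀ w : List Bool, (w ∈ T.1 → p (Encodable.encode w) = 1) ∧
    (w ∉ T.1 → p (Encodable.encode w) = 0)
  unique := by
    intro p S T hS hT
    apply Subtype.ext
    ext w
    have h1 := hS w
    have h2 := hT w
    by_cases a : w ∈ S.1 <;> by_cases b : w ∈ T.1 <;> simp_all
  surj := by
    classical
    intro T
    refine ⟨fun c => match (Encodable.decode c : Option (List Bool)) with
      | none => 0
      | some w => if w ∈ T.1 then 1 else 0, ?_⟩
    intro w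
    simp only [Encodable.encodek]
    exact ⟨fun h => if_pos h, fun h => if_neg h⟩

/-! ### Multi-valued functions on represented spaces and Weihrauch reducibility -/

/-- A partial multi-valued function `f : ⊆ X ⇉ Y` on represented spaces, given by the sets `f x`
of its values; its domain consists of the `x` with `f x ≠ ∅`. -/
structure MultiFun where
  X : Type u
  Y : Type v
  inRep : Representation X
  outRep : Representation Y
  val : X → Set Y

namespace MultiFun

/-- The domain of a partial multi-valued function. -/
def dom (f : MultiFun.{u, v}) : Set f.X := {x | (f.val x).Nonempty}

/-- `F ⊢ f`: the partial function `F` on Baire space is a realizer of `f`. -/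
def Realizes (F : (ℕ → ℕ) →. (ℕ → ℕ)) (f : MultiFun.{u, v}) : Prop :=
  ∀ p x, f.inRep.Names p x → x ∈ f.dom → ∃ q ∈ F p, ∃ y ∈ f.val x, f.outRep.Names q y

/-- Weihrauch reducibility: `H⟨id, G K⟩ ⊢ f` for all `G ⊢ g`. -/
def LeW (f : MultiFun.{u, v}) (g : MultiFun.{u', v'}) : Prop :=
  ∃ K H : (ℕ → ℕ) →. (ℕ → ℕ), ComputableFun K ∧ ComputableFun H ∧
    ∀ G, Realizes G g →
      Realizes (fun p => (K p).bind fun k => (G k).bind fun q => H (pairSeq p q)) f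

/-- Strong Weihrauch reducibility: `H G K ⊢ f` for all `G ⊢ g`. -/
def LeSW (f : MultiFun.{u, v}) (g : MultiFun.{u', v'}) : Prop :=
  ∃ K H : (ℕ → ℕ) →. (ℕ → ℕ), ComputableFun K ∧ ComputableFun H ∧
    ∀ G, Realizes G g → Realizes (fun p => (K p).bind fun k => (G k).bind fun q => H q) f

/-- Strong Weihrauch equivalence. -/
def EquivSW (f : MultiFun.{u, v}) (g : MultiFun.{u', v'}) : Prop := LeSW f g ∧ LeSW g f

/-- The discrete jump `f^Δ`: the input representation is replaced by its discrete jump. -/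
def discreteJump (f : MultiFun.{u, v}) : MultiFun.{u, v} := { f with inRep := f.inRep.discreteJump }

/-! ### Probabilistic choice, Weak Weak Kőnig's Lemma -/

/-- Probabilistic choice `P_I C_X`: given a closed set `A` of measure in `I` by negative
information, find a point of `A`. -/
noncomputable def probChoice {X : Type u} [MeasurableSpace X] (δ : Representation X) (μ : Measure X)
    (I : Set ℝ≥0∞) : MultiFun.{u, u} where
  X := δ.Closeds
  Y := X
  inRep := δ.negative
  outRep := δ
  val A := {x | x ∈ A.1 ∧ μ A.1 ∈ I}

/-- Positive choice `PC_X = P_{(0,∞]} C_X`. -/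
noncomputable def posChoice {X : Type u} [MeasurableSpace X] (δ : Representation X)
    (μ : Measure X) : MultiFun.{u, u} :=
  probChoice δ μ (Set.Ioc 0 ⊤)

/-- The uniform measure on Cantor space: the product of the uniform measures on `{0, 1}`. -/
noncomputable def cantorMeasure : Measure (ℕ → Bool) :=
  Measure.infinitePi fun _ => (PMF.uniformOfFintype Bool).toMeasure

/-- The product of the counting measure on `ℕ` and the uniform measure on Cantor space. -/
noncomputable def natCantorMeasure : Measure (ℕ × (ℕ → Bool)) :=
  (Measure.count : Measure ℕ).prod cantorMeasure

/-- `PC_{2^ℕ}`. -/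
noncomputable def PCCantor : MultiFun.{0, 0} := posChoice Representation.cantor cantorMeasure

/-- `PC_{ℕ × 2^ℕ}`. -/
noncomputable def PCNatCantor : MultiFun.{0, 0} := posChoice Representation.natCantor natCantorMeasure

/-- `PC_ℝ`, for Lebesgue measure. -/
noncomputable def PCReal : MultiFun.{0, 0} := posChoice Representation.real volume

/-- Weak Weak Kőnig's Lemma: given a binary tree whose set of infinite paths has positive measure,
find an infinite path. -/
noncomputable def WWKL : MultiFun.{0, 0} where
  X := BinTree
  Y := ℕ → Bool
  inRep := Representation.tree
  outRep := Representation.cantor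
  val T := {x | x ∈ T.paths ∧ 0 < cantorMeasure T.paths}

/-! ### Las Vegas computability -/

/-- The set `S_p` of successful advices `r ∈ R` on input `p`, for the failure recognition
function `F₂`. -/
def successSet (R : Set (ℕ → ℕ)) (F₂ : (ℕ → ℕ) →. (ℕ → ℕ)) (p : ℕ → ℕ) : Set R :=
  {r | ∃ s ∈ F₂ (pairSeq p r), Representation.sierpinski.Names s false}

/-- `f` is Las Vegas computable over `R ⊆ ℕ^ℕ` (with Borel measure `μ`) with measure in `I`. -/
def LasVegasOver (f : MultiFun.{u, v}) (R : Set (ℕ → ℕ)) (μ : Measure R) (I : Set ℝ≥0∞) : Prop :=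
  ∃ F₁ F₂ : (ℕ → ℕ) →. (ℕ → ℕ), ComputableFun F₁ ∧ ComputableFun F₂ ∧
    ∀ p x, f.inRep.Names p x → x ∈ f.dom →
      (∀ r ∈ R, (F₂ (pairSeq p r)).Dom) ∧
      (successSet R F₂ p).Nonempty ∧ μ (successSet R F₂ p) ∈ I ∧
      ∀ r ∈ successSet R F₂ p, ∃ q ∈ F₁ (pairSeq p r), ∃ y ∈ f.val x, f.outRep.Names q y

/-- The map of `ℕ × 2^ℕ` onto its copy in Baire space. -/
def toBaire (a : ℕ × (ℕ → Bool)) : Set.range Representation.natBits :=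
  ⟨Representation.natBits a, a, rfl⟩

theorem measurable_toBaire : Measurable toBaire := by
  refine Measurable.subtype_mk (measurable_pi_iff.2 fun i => ?_)
  cases i with
  | zero => exact measurable_fst
  | succ i =>
    exact (measurable_of_countable Bool.toNat).comp ((measurable_pi_apply i).comp measurable_snd)

/-- `f` is Las Vegas computable with finitely many mind changes: Las Vegas computable over
`ℕ × 2^ℕ` (as a subset of Baire space, with the product of the counting measure and the uniform
measure) with measure in `(0, ∞]`. -/
def LasVegasFMC (f : MultiFun.{u, v}) : Prop :=
  LasVegasOver f (Set.range Representation.natBits) (natCantorMeasure.map toBaire) (Set.Ioc 0 ⊤)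

end MultiFun

end Weihrauch

/-! ### Primitive recursion: composition rules for `fun_prop` -/

attribute [fun_prop] Primrec PrimrecPred

namespace Primrec

variable {α β γ σ : Type*} [Primcodable α] [Primcodable β] [Primcodable γ] [Primcodable σ]

@[fun_prop] theorem fp_id : Primrec (fun a : α => a) := Primrec.id

@[fun_prop] theorem fp_const (x : σ) : Primrec (fun _ : α => x) := Primrec.const x

@[fun_prop] theorem fp_comp {f : β → σ} {g : α → β} (hf : Primrec f) (hg : Primrec g) :
    Primrec (fun a => f (g a)) := hf.comp hg

@[fun_prop] theorem fp_pred_comp {f : β → Prop} {g : α → β} (hf : PrimrecPred f)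
    (hg : Primrec g) : PrimrecPred (fun a => f (g a)) := hf.comp hg

@[fun_prop] theorem fp_pair {f : α → β} {g : α → γ} (hf : Primrec f) (hg : Primrec g) :
    Primrec (fun a => (f a, g a)) := hf.pair hg

@[fun_prop] theorem fp_fst {f : α → β × γ} (hf : Primrec f) : Primrec (fun a => (f a).1) :=
  Primrec.fst.comp hf

@[fun_prop] theorem fp_snd {f : α → β × γ} (hf : Primrec f) : Primrec (fun a => (f a).2) :=
  Primrec.snd.comp hf

@[fun_prop] theorem fp_add {f g : α → ℕ} (hf : Primrec f) (hg : Primrec g) :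
    Primrec (fun a => f a + g a) := Primrec.nat_add.comp hf hg

@[fun_prop] theorem fp_sub {f g : α → ℕ} (hf : Primrec f) (hg : Primrec g) :
    Primrec (fun a => f a - g a) := Primrec.nat_sub.comp hf hg

@[fun_prop] theorem fp_mul {f g : α → ℕ} (hf : Primrec f) (hg : Primrec g) :
    Primrec (fun a => f a * g a) := Primrec.nat_mul.comp hf hg

@[fun_prop] theorem fp_div {f g : α → ℕ} (hf : Primrec f) (hg : Primrec g) :
    Primrec (fun a => f a / g a) := Primrec.nat_div.comp hf hg

@[fun_prop] theorem fp_mod {f g : α → ℕ} (hf : Primrec f) (hg : Primrec g) :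
    Primrec (fun a => f a % g a) := Primrec.nat_mod.comp hf hg

@[fun_prop] theorem fp_pow {f g : α → ℕ} (hf : Primrec f) (hg : Primrec g) :
    Primrec (fun a => f a ^ g a) :=
  (Primrec₂.unpaired'.1 Nat.Primrec.pow).comp hf hg

@[fun_prop] theorem fp_max {f g : α → ℕ} (hf : Primrec f) (hg : Primrec g) :
    Primrec (fun a => max (f a) (g a)) := Primrec.nat_max.comp hf hg

@[fun_prop] theorem fp_min {f g : α → ℕ} (hf : Primrec f) (hg : Primrec g) :
    Primrec (fun a => min (f a) (g a)) := Primrec.nat_min.comp hf hg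

@[fun_prop] theorem fp_natPair {f g : α → ℕ} (hf : Primrec f) (hg : Primrec g) :
    Primrec (fun a => Nat.pair (f a) (g a)) := Primrec₂.natPair.comp hf hg

@[fun_prop] theorem fp_unpair {f : α → ℕ} (hf : Primrec f) :
    Primrec (fun a => Nat.unpair (f a)) := Primrec.unpair.comp hf

@[fun_prop] theorem fp_toNat {f : α → Bool} (hf : Primrec f) :
    Primrec (fun a => (f a).toNat) := (Primrec.dom_bool _).comp hf

@[fun_prop] theorem fp_encode {f : α → β} (hf : Primrec f) :
    Primrec (fun a => Encodable.encode (f a)) := Primrec.encode.comp hf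

@[fun_prop] theorem fp_decode {f : α → ℕ} (hf : Primrec f) :
    Primrec (fun a => (Encodable.decode (f a) : Option β)) := Primrec.decode.comp hf

@[fun_prop] theorem fp_some {f : α → β} (hf : Primrec f) :
    Primrec (fun a => some (f a)) := Primrec.option_some.comp hf

@[fun_prop] theorem fp_getD {f : α → Option β} {g : α → β} (hf : Primrec f) (hg : Primrec g) :
    Primrec (fun a => (f a).getD (g a)) := Primrec.option_getD.comp hf hg

@[fun_prop] theorem fp_option_map {f : α → Option β} {g : α → β → σ} (hf : Primrec f)
    (hg : Primrec fun z : α × β => g z.1 z.2) : Primrec (fun a => (f a).map (g a)) :=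
  Primrec.option_map hf hg

@[fun_prop] theorem fp_cons {f : α → β} {g : α → List β} (hf : Primrec f) (hg : Primrec g) :
    Primrec (fun a => f a :: g a) := Primrec.list_cons.comp hf hg

@[fun_prop] theorem fp_tail {f : α → List β} (hf : Primrec f) :
    Primrec (fun a => (f a).tail) := Primrec.list_tail.comp hf

@[fun_prop] theorem fp_take {f : α → ℕ} {g : α → List β} (hf : Primrec f) (hg : Primrec g) :
    Primrec (fun a => (g a).take (f a)) := Primrec.list_take.comp hf hg

@[fun_prop] theorem fp_drop {f : α → ℕ} {g : α → List β} (hf : Primrec f) (hg : Primrec g) :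
    Primrec (fun a => (g a).drop (f a)) := Primrec.list_drop.comp hf hg

@[fun_prop] theorem fp_length {f : α → List β} (hf : Primrec f) :
    Primrec (fun a => (f a).length) := Primrec.list_length.comp hf

@[fun_prop] theorem fp_map {f : α → List β} {g : α → β → σ} (hf : Primrec f)
    (hg : Primrec fun z : α × β => g z.1 z.2) : Primrec (fun a => (f a).map (g a)) :=
  Primrec.list_map hf hg

@[fun_prop] theorem fp_range {f : α → ℕ} (hf : Primrec f) :
    Primrec (fun a => List.range (f a)) := Primrec.list_range.comp hf

@[fun_prop] theorem fp_getElem? {f : α → List β} {g : α → ℕ} (hf : Primrec f)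
    (hg : Primrec g) : Primrec (fun a => (f a)[g a]?) := Primrec.list_getElem?.comp hf hg

@[fun_prop] theorem fp_ite {c : α → Prop} [DecidablePred c] {f g : α → σ} (hc : PrimrecPred c)
    (hf : Primrec f) (hg : Primrec g) : Primrec (fun a => if c a then f a else g a) :=
  Primrec.ite hc hf hg

@[fun_prop] theorem fp_decide {c : α → Prop} [DecidablePred c] (hc : PrimrecPred c) :
    Primrec (fun a => decide (c a)) := hc.decide

@[fun_prop] theorem fp_findIdx {f : α → List β} {p : α → β → Bool} (hf : Primrec f)
    (hp : Primrec fun z : α × β => p z.1 z.2) : Primrec (fun a => (f a).findIdx (p a)) :=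
  Primrec.list_findIdx hf hp

@[fun_prop] theorem fp_filter {f : α → List β} {p : α → β → Bool} (hf : Primrec f)
    (hp : Primrec fun z : α × β => p z.1 z.2) : Primrec (fun a => (f a).filter (p a)) := by
  have h : Primrec fun a => (f a).filterMap fun b => if p a b = true then some b else none := by
    refine Primrec.listFilterMap hf (Primrec.ite ?_ ?_ ?_)
    · exact Primrec.eq.comp hp (Primrec.const true)
    · exact Primrec.option_some.comp Primrec.snd
    · exact Primrec.const none
  refine h.of_eq fun a => ?_
  rw [← List.filterMap_eq_filter]
  rfl

@[fun_prop] theorem fp_lt {f g : α → ℕ} (hf : Primrec f) (hg : Primrec g) :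
    PrimrecPred (fun a => f a < g a) := Primrec.nat_lt.comp hf hg

@[fun_prop] theorem fp_le {f g : α → ℕ} (hf : Primrec f) (hg : Primrec g) :
    PrimrecPred (fun a => f a ≤ g a) := Primrec.nat_le.comp hf hg

@[fun_prop] theorem fp_eq {f g : α → β} (hf : Primrec f) (hg : Primrec g) :
    PrimrecPred (fun a => f a = g a) := Primrec.eq.comp hf hg

@[fun_prop] theorem fp_and {f g : α → Prop} (hf : PrimrecPred f) (hg : PrimrecPred g) :
    PrimrecPred (fun a => f a ∧ g a) := hf.and hg

@[fun_prop] theorem fp_or {f g : α → Prop} (hf : PrimrecPred f) (hg : PrimrecPred g) :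
    PrimrecPred (fun a => f a ∨ g a) := hf.or hg

@[fun_prop] theorem fp_not {f : α → Prop} (hf : PrimrecPred f) :
    PrimrecPred (fun a => ¬ f a) := hf.not

@[fun_prop] theorem fp_exists_lt {f : α → ℕ} {p : α → ℕ → Prop} (hf : Primrec f)
    (hp : PrimrecPred fun z : α × ℕ => p z.1 z.2) :
    PrimrecPred (fun a => ∃ x, x < f a ∧ p a x) := by
  have h : PrimrecRel fun x a => p a x := hp.comp (Primrec.snd.pair Primrec.fst)
  refine (h.exists_mem_list.comp (Primrec.list_range.comp hf) Primrec.id).of_eq fun a => ?_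
  simp

@[fun_prop] theorem fp_foldl {f : α → List β} {g : α → σ} {h : σ → β → σ} (hf : Primrec f)
    (hg : Primrec g) (hh : Primrec fun z : σ × β => h z.1 z.2) :
    Primrec (fun a => (f a).foldl h (g a)) :=
  Primrec.list_foldl (h := fun _ z => h z.1 z.2) hf hg (hh.comp Primrec.snd)

end Primrec

namespace Weihrauch

/-! ### Prefixes -/

@[simp] theorem length_pre (p : ℕ → ℕ) (n : ℕ) : (pre p n).length = n := by simp [pre]

@[simp] theorem pre_zero (p : ℕ → ℕ) : pre p 0 = [] := rfl

theorem pre_succ (p : ℕ → ℕ) (n : ℕ) : pre p (n + 1) = pre p n ++ [p n] := by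
  simp [pre, List.range_succ]

theorem take_pre (p : ℕ → ℕ) (m n : ℕ) : (pre p n).take m = pre p (min m n) := by
  simp [pre, ← List.map_take, List.take_range]

theorem take_pre_of_le (p : ℕ → ℕ) {m n : ℕ} (h : m ≤ n) : (pre p n).take m = pre p m := by
  rw [take_pre, min_eq_left h]

theorem pre_prefix (p : ℕ → ℕ) {m n : ℕ} (h : m ≤ n) : pre p m <+: pre p n := by
  rw [← take_pre_of_le p h]; exact List.take_prefix _ _

theorem getElem?_pre (p : ℕ → ℕ) {i n : ℕ} (h : i < n) : (pre p n)[i]? = some (p i) := by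
  simp [pre, h]

theorem getElem?_pre_eq_some {p : ℕ → ℕ} {i n a : ℕ} :
    (pre p n)[i]? = some a ↔ i < n ∧ p i = a := by
  by_cases h : i < n
  · rw [getElem?_pre p h]; simp [h]
  · simp [pre, h]

theorem getElem?_of_prefix {α : Type*} {u v : List α} (h : u <+: v) {i : ℕ} (hi : i < u.length) :
    v[i]? = u[i]? := by
  obtain ⟨w, rfl⟩ := h
  exact List.getElem?_append_left hi

theorem take_of_prefix {α : Type*} {u v : List α} (h : u <+: v) {i : ℕ} (hi : i ≤ u.length) :
    v.take i = u.take i := by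
  obtain ⟨w, rfl⟩ := h
  exact List.take_append_of_le_length hi

theorem pre_congr {p q : ℕ → ℕ} {n : ℕ} (h : ∀ i < n, p i = q i) : pre p n = pre q n := by
  simp only [pre, List.map_inj_left, List.mem_range]
  exact h

theorem pre_consSeq (k : ℕ) (p : ℕ → ℕ) (n : ℕ) : pre (consSeq k p) (n + 1) = k :: pre p n := by
  simp only [pre, List.range_succ_eq_map, List.map_cons, List.map_map]
  rfl

/-! ### Computable functions on Baire space -/

/-- The output produced on the word `u` after `m` steps: in step `m` the prefix of length `m + 1`
is consulted for the next value. -/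
def stepRun (g : List ℕ → ℕ → Option ℕ) (u : List ℕ) : ℕ → List ℕ
  | 0 => []
  | m + 1 => stepRun g u m ++ (g (u.take (m + 1)) (stepRun g u m).length).toList

theorem stepRun_prefix (g : List ℕ → ℕ → Option ℕ) (u : List ℕ) {m n : ℕ} (h : m ≤ n) :
    stepRun g u m <+: stepRun g u n := by
  induction n, h using Nat.le_induction with
  | base => exact List.prefix_rfl
  | succ n _ ih => exact ih.trans (List.prefix_append _ _)

theorem stepRun_congr (g : List ℕ → ℕ → Option ℕ) {u v : List ℕ} (h : u <+: v) {m : ℕ}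
    (hm : m ≤ u.length) : stepRun g u m = stepRun g v m := by
  induction m with
  | zero => rfl
  | succ m ih =>
    rw [stepRun, stepRun, ih (by omega), take_of_prefix h hm]

theorem computable_stepRun {g : List ℕ → ℕ → Option ℕ}
    (hg : Computable fun z : List ℕ × ℕ => g z.1 z.2) :
    Computable fun u : List ℕ => stepRun g u u.length := by
  have h1 : Computable₂ fun (u : List ℕ) (z : ℕ × List ℕ) => u.take (z.1 + 1) :=
    (show Primrec fun y : List ℕ × ℕ × List ℕ => y.1.take (y.2.1 + 1) by fun_prop).to_comp
  have h2 : Computable₂ fun (u : List ℕ) (z : ℕ × List ℕ) => z.2.length :=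
    (show Primrec fun y : List ℕ × ℕ × List ℕ => y.2.2.length by fun_prop).to_comp
  have h3 : Computable₂ fun (u : List ℕ) (z : ℕ × List ℕ) =>
      z.2 ++ (g (u.take (z.1 + 1)) z.2.length).toList :=
    Computable.list_append.comp (Computable.snd.comp Computable.snd)
      (Primrec.optionToList.to_comp.comp (hg.comp (Computable.pair h1 h2)))
  refine (Computable.nat_rec Computable.list_length (Computable.const []) h3).of_eq fun u => ?_
  generalize u.length = n
  induction n with
  | zero => rfl
  | succ n ih => simp only [stepRun, ← ih]

/-- A partial function on Baire space is computable if its values can be computed one by one from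
sufficiently long prefixes of the argument. -/
theorem computableFun_of_step {F : (ℕ → ℕ) →. (ℕ → ℕ)} {g : List ℕ → ℕ → Option ℕ}
    (hg : Computable fun z : List ℕ × ℕ => g z.1 z.2)
    (hF : ∀ p, ∀ q ∈ F p, (∀ m n a, g (pre p m) n = some a → a = q n) ∧
      ∀ n, ∃ m₀, ∀ m, m₀ ≤ m → g (pre p m) n ≠ none) : ComputableFun F := by
  refine ⟨fun u => stepRun g u u.length, computable_stepRun hg, fun u v h => ?_, ?_⟩
  · show stepRun g u u.length <+: stepRun g v v.length
    rw [stepRun_congr g h le_rfl]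
    exact stepRun_prefix g v h.length_le
  · intro p q hq
    obtain ⟨h1, h2⟩ := hF p q hq
    have hs : ∀ n, stepRun g (pre p (n + 1)) (n + 1) = stepRun g (pre p n) n ++
        (g (pre p (n + 1)) (stepRun g (pre p n) n).length).toList := by
      intro n
      rw [stepRun, ← stepRun_congr g (pre_prefix p (Nat.le_succ n)) (m := n) (by simp),
        take_pre_of_le p le_rfl]
    have hcorr : ∀ n, stepRun g (pre p n) n = pre q (stepRun g (pre p n) n).length := by
      intro n
      induction n with
      | zero => simp [stepRun]
      | succ n ih =>
        rw [hs]
        rcases hgn : g (pre p (n + 1)) (stepRun g (pre p n) n).length with _ | a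
        · simpa using ih
        · have := h1 _ _ _ hgn
          simp only [Option.toList_some, List.length_append, List.length_singleton, pre_succ]
          rw [← ih, this]
    have hmono : ∀ {m n}, m ≤ n →
        (stepRun g (pre p m) m).length ≤ (stepRun g (pre p n) n).length := by
      intro m n h
      refine monotone_nat_of_le_succ (f := fun n => (stepRun g (pre p n) n).length)
        (fun n => ?_) h
      simp only [hs, List.length_append]
      omega
    intro k
    suffices ∃ n, k ≤ (stepRun g (pre p n) n).length by
      obtain ⟨n, hn⟩ := this
      refine ⟨n, ?_⟩
      simp only [length_pre]
      rw [hcorr n]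
      exact pre_prefix q hn
    induction k with
    | zero => exact ⟨0, Nat.zero_le _⟩
    | succ k ih =>
      obtain ⟨n, hn⟩ := ih
      obtain ⟨m₀, hm₀⟩ := h2 k
      by_contra! hlt
      have hlen : (stepRun g (pre p (max n m₀)) (max n m₀)).length = k := by
        have := hmono (le_max_left n m₀)
        have := hlt (max n m₀)
        omega
      have := hlt (max n m₀ + 1)
      rw [hs, hlen, List.length_append, hlen] at this
      rcases hgn : g (pre p (max n m₀ + 1)) k with _ | a
      · exact hm₀ _ (by omega) hgn
      · rw [hgn] at this
        simp at this

/-- A total function on Baire space is computable if its `n`-th value is computed from a prefix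
of computable length. -/
theorem computableFun_of_bounded {K : (ℕ → ℕ) → ℕ → ℕ} {G : List ℕ → ℕ → ℕ} {b : ℕ → ℕ}
    (hG : Computable fun z : List ℕ × ℕ => G z.1 z.2) (hb : Primrec b)
    (hK : ∀ p n, K p n = G (pre p (b n)) n) :
    ComputableFun fun p => Part.some (K p) := by
  refine computableFun_of_step (g := fun u n => bif decide (b n ≤ u.length) then
    some (G (u.take (b n)) n) else none) ?_ ?_
  · refine Computable.cond ?_ ?_ (Computable.const _)
    · exact (show Primrec fun z : List ℕ × ℕ => decide (b z.2 ≤ z.1.length) by fun_prop).to_comp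
    · have h : Computable fun z : List ℕ × ℕ => (z.1.take (b z.2), z.2) :=
        (show Primrec fun z : List ℕ × ℕ => (z.1.take (b z.2), z.2) by fun_prop).to_comp
      exact Computable.option_some.comp (hG.comp h)
  · intro p q hq
    obtain rfl := Part.mem_some_iff.1 hq
    refine ⟨fun m n a h => ?_, fun n => ⟨b n, fun m hm => ?_⟩⟩
    · by_cases hbm : b n ≤ m
      · simp only [length_pre, hbm, decide_true, cond_true, Option.some.injEq,
          take_pre_of_le p hbm] at h
        rw [hK, h]
      · simp [hbm] at h
    · simp [hm]

theorem pre_of_computableFun {F : (ℕ → ℕ) →. (ℕ → ℕ)} {φ : List ℕ → List ℕ}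
    (hmono : ∀ u v, u <+: v → φ u <+: φ v)
    (hφ : ∀ p, ∀ q ∈ F p, ∀ k, ∃ n, pre q k <+: φ (pre p n)) {p q : ℕ → ℕ} (hq : q ∈ F p)
    (n : ℕ) : φ (pre p n) = pre q (φ (pre p n)).length := by
  obtain ⟨m, hm⟩ := hφ p q hq (φ (pre p n)).length
  have h1 : φ (pre p n) <+: φ (pre p (max n m)) := hmono _ _ (pre_prefix p (le_max_left _ _))
  have h2 := hm.trans (hmono _ _ (pre_prefix p (le_max_right n m)))
  exact (List.prefix_of_prefix_length_le h1 h2 (by simp)).eq_of_length (by simp)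

theorem ComputableFun.comp {F G : (ℕ → ℕ) →. (ℕ → ℕ)} (hF : ComputableFun F)
    (hG : ComputableFun G) : ComputableFun fun p => (F p).bind G := by
  obtain ⟨φ, h1, h2, h3⟩ := hF
  obtain ⟨ψ, g1, g2, g3⟩ := hG
  refine ⟨fun u => ψ (φ u), g1.comp h1, fun u v h => g2 _ _ (h2 _ _ h), ?_⟩
  intro p r hr k
  obtain ⟨q, hq, hr⟩ := Part.mem_bind_iff.1 hr
  obtain ⟨m, hm⟩ := g3 q r hr k
  obtain ⟨n, hn⟩ := h3 p q hq m
  exact ⟨n, hm.trans (g2 _ _ hn)⟩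

/-! ### Splitting a paired sequence -/

/-- The first component of a paired sequence. -/
def fstSeq (s : ℕ → ℕ) : ℕ → ℕ := fun n => s (2 * n)

/-- The second component of a paired sequence. -/
def sndSeq (s : ℕ → ℕ) : ℕ → ℕ := fun n => s (2 * n + 1)

@[simp] theorem fstSeq_pairSeq (p q : ℕ → ℕ) : fstSeq (pairSeq p q) = p := by
  funext n
  simp [fstSeq, pairSeq]

@[simp] theorem sndSeq_pairSeq (p q : ℕ → ℕ) : sndSeq (pairSeq p q) = q := by
  funext n
  have h1 : (2 * n + 1) % 2 = 1 := by omega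
  have h2 : (2 * n + 1) / 2 = n := by omega
  simp [sndSeq, pairSeq, h1, h2]

/-- The letters at even positions of a word. -/
def fstWord (u : List ℕ) : List ℕ := (List.range (u.length / 2)).map fun i => u[2 * i]?.getD 0

/-- The letters at odd positions of a word. -/
def sndWord (u : List ℕ) : List ℕ := (List.range (u.length / 2)).map fun i => u[2 * i + 1]?.getD 0

/-- The pairing of two words, as far as both are defined. -/
def pairWord (u v : List ℕ) : List ℕ :=
  (List.range (2 * min u.length v.length)).map fun i =>
    if i % 2 = 0 then u[i / 2]?.getD 0 else v[i / 2]?.getD 0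

@[fun_prop] theorem primrec_fstWord : Primrec fstWord := by unfold fstWord; fun_prop

@[fun_prop] theorem primrec_sndWord : Primrec sndWord := by unfold sndWord; fun_prop

@[fun_prop] theorem primrec_pairWord : Primrec fun z : List ℕ × List ℕ => pairWord z.1 z.2 := by
  unfold pairWord; fun_prop

theorem fstWord_mono {u v : List ℕ} (h : u <+: v) : fstWord u <+: fstWord v := by
  have hl := h.length_le
  have : fstWord u = (fstWord v).take (u.length / 2) := by
    simp only [fstWord, ← List.map_take, List.take_range]
    rw [min_eq_left (by omega)]
    refine List.map_congr_left fun i hi => ?_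
    rw [getElem?_of_prefix h (by have := List.mem_range.1 hi; omega)]
  rw [this]
  exact List.take_prefix _ _

theorem sndWord_mono {u v : List ℕ} (h : u <+: v) : sndWord u <+: sndWord v := by
  have hl := h.length_le
  have : sndWord u = (sndWord v).take (u.length / 2) := by
    simp only [sndWord, ← List.map_take, List.take_range]
    rw [min_eq_left (by omega)]
    refine List.map_congr_left fun i hi => ?_
    rw [getElem?_of_prefix h (by have := List.mem_range.1 hi; omega)]
  rw [this]
  exact List.take_prefix _ _

theorem fstWord_pre (s : ℕ → ℕ) (n : ℕ) : fstWord (pre s n) = pre (fstSeq s) (n / 2) := by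
  simp only [fstWord, length_pre]
  refine List.map_congr_left fun i hi => ?_
  rw [getElem?_pre s (by have := List.mem_range.1 hi; omega)]
  rfl

theorem sndWord_pre (s : ℕ → ℕ) (n : ℕ) : sndWord (pre s n) = pre (sndSeq s) (n / 2) := by
  simp only [sndWord, length_pre]
  refine List.map_congr_left fun i hi => ?_
  rw [getElem?_pre s (by have := List.mem_range.1 hi; omega)]
  rfl

theorem pairWord_pre (p q : ℕ → ℕ) (m n : ℕ) :
    pairWord (pre p m) (pre q n) = pre (pairSeq p q) (2 * min m n) := by
  simp only [pairWord, length_pre]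
  refine List.map_congr_left fun i hi => ?_
  have := List.mem_range.1 hi
  rw [getElem?_pre p (by omega), getElem?_pre q (by omega)]
  rfl

theorem pairWord_mono {u u' v v' : List ℕ} (hu : u <+: u') (hv : v <+: v') :
    pairWord u v <+: pairWord u' v' := by
  have h1 := hu.length_le
  have h2 := hv.length_le
  have : pairWord u v = (pairWord u' v').take (2 * min u.length v.length) := by
    simp only [pairWord, ← List.map_take, List.take_range]
    rw [min_eq_left (show 2 * min u.length v.length ≤ 2 * min u'.length v'.length by omega)]
    refine List.map_congr_left fun i hi => ?_
    have := List.mem_range.1 hi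
    rw [getElem?_of_prefix hu (by omega), getElem?_of_prefix hv (by omega)]
  rw [this]
  exact List.take_prefix _ _

/-! ### Reductions -/

namespace MultiFun

/-- A strong reduction given by a total map on names. -/
theorem leSW_of_total {f : MultiFun.{u, v}} {g : MultiFun.{u', v'}} {K : (ℕ → ℕ) → ℕ → ℕ}
    {H : (ℕ → ℕ) →. (ℕ → ℕ)} (hK : ComputableFun fun p => Part.some (K p)) (hH : ComputableFun H)
    (h : ∀ p x, f.inRep.Names p x → x ∈ f.dom → ∃ x', g.inRep.Names (K p) x' ∧ x' ∈ g.dom ∧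
      ∀ q, ∀ y' ∈ g.val x', g.outRep.Names q y' →
        ∃ r ∈ H q, ∃ y ∈ f.val x, f.outRep.Names r y) : LeSW f g := by
  refine ⟨_, H, hK, hH, fun G hG p x hp hx => ?_⟩
  obtain ⟨x', h1, h2, h3⟩ := h p x hp hx
  obtain ⟨q, hq, y', hy', hn⟩ := hG _ _ h1 h2
  obtain ⟨r, hr, y, hy, hry⟩ := h3 q y' hy' hn
  exact ⟨r, Part.mem_bind_iff.2 ⟨_, Part.mem_some _, Part.mem_bind_iff.2 ⟨q, hq, hr⟩⟩, y, hy, hry⟩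

theorem LeSW.trans {f : MultiFun.{u, v}} {g h : MultiFun.{u', v'}}
    (hfg : LeSW f g) (hgh : LeSW g h) : LeSW f h := by
  obtain ⟨K, H, hK, hH, r⟩ := hfg
  obtain ⟨K', H', hK', hH', r'⟩ := hgh
  refine ⟨_, _, hK.comp hK', hH'.comp hH, fun G hG => ?_⟩
  intro p x hp hx
  obtain ⟨q, hq, hy⟩ := r _ (r' G hG) p x hp hx
  refine ⟨q, ?_, hy⟩
  simp only [Part.mem_bind_iff] at hq ⊢
  obtain ⟨k, hk, l, ⟨k', hk', t, ht, hl⟩, hq⟩ := hq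
  exact ⟨k', Part.mem_bind hk hk', t, ht, Part.mem_bind hl hq⟩

theorem LeW.trans_leSW {f : MultiFun.{u, v}} {g h : MultiFun.{u', v'}}
    (hfg : LeW f g) (hgh : LeSW g h) : LeW f h := by
  obtain ⟨K, H, hK, ⟨φ, c1, m1, a1⟩, r⟩ := hfg
  obtain ⟨K', H', hK', ⟨ψ, c2, m2, a2⟩, r'⟩ := hgh
  refine ⟨_, fun s => (H' (sndSeq s)).bind fun q => H (pairSeq (fstSeq s) q),
    hK.comp hK', ?_, fun G hG => ?_⟩
  · refine ⟨fun u => φ (pairWord (fstWord u) (ψ (sndWord u))), ?_, ?_, ?_⟩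
    · exact c1.comp (primrec_pairWord.to_comp.comp (primrec_fstWord.to_comp.pair
        (c2.comp primrec_sndWord.to_comp)))
    · exact fun u v h => m1 _ _ (pairWord_mono (fstWord_mono h) (m2 _ _ (sndWord_mono h)))
    · intro s q hq k
      obtain ⟨t, ht, hq⟩ := Part.mem_bind_iff.1 hq
      obtain ⟨m, hm⟩ := a1 _ _ hq k
      obtain ⟨n, hn⟩ := a2 _ _ ht m
      refine ⟨2 * max m n, hm.trans (m1 _ _ ?_)⟩
      have e : 2 * max m n / 2 = max m n := by omega
      rw [fstWord_pre, sndWord_pre, e]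
      have h1 := pairWord_mono (pre_prefix (fstSeq s) (le_max_left m n))
        (hn.trans (m2 _ _ (pre_prefix (sndSeq s) (le_max_right m n))))
      rw [pairWord_pre, min_self] at h1
      exact (pre_prefix _ (by omega)).trans h1
  · intro p x hp hx
    obtain ⟨q, hq, hy⟩ := r _ (r' G hG) p x hp hx
    refine ⟨q, ?_, hy⟩
    simp only [Part.mem_bind_iff, sndSeq_pairSeq, fstSeq_pairSeq] at hq ⊢
    obtain ⟨k, hk, l, ⟨k', hk', t, ht, hl⟩, hq⟩ := hq
    exact ⟨k', Part.mem_bind hk hk', t, ht, l, hl, hq⟩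

end MultiFun

/-! ### Names of closed sets -/

/-- The index `⟨n, u⟩` at which an associate is consulted. -/
def query (c : ℕ) : ℕ × List ℕ := (Encodable.decode c : Option (ℕ × List ℕ)).getD (0, [])

@[simp] theorem query_encode (z : ℕ × List ℕ) : query (Encodable.encode z) = z := by
  rw [query, Encodable.encodek, Option.getD_some]

@[fun_prop] theorem primrec_query : Primrec query := by unfold query; fun_prop

/-- The associate that signals, on an argument with prefix `u`, evidence found in the prefixes of
the same length of `p` and of the argument. -/
def associate (E : List ℕ → List ℕ → Bool) (p : ℕ → ℕ) (c : ℕ) : ℕ :=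
  if (query c).2.length < (query c).1 then 0 else
    if E (pre p (query c).1) (query c).2 then 2 else 1

theorem computableFun_associate {E : List ℕ → List ℕ → Bool}
    (hE : Computable fun z : List ℕ × List ℕ => E z.1 z.2) :
    ComputableFun fun p => Part.some (associate E p) := by
  refine computableFun_of_bounded (b := fun c => (query c).1)
    (G := fun v c => bif decide ((query c).2.length < (query c).1) then 0 else
      bif E v (query c).2 then 2 else 1) ?_ (by fun_prop) ?_
  · refine Computable.cond ?_ (Computable.const _)
      (Computable.cond ?_ (Computable.const _) (Computable.const _))
    · exact (show Primrec fun z : List ℕ × ℕ =>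
        decide ((query z.2).2.length < (query z.2).1) by fun_prop).to_comp
    · have h : Computable fun z : List ℕ × ℕ => (z.1, (query z.2).2) :=
        (show Primrec fun z : List ℕ × ℕ => (z.1, (query z.2).2) by fun_prop).to_comp
      exact hE.comp h
  · intro p c
    simp [associate, cond_eq_ite]

namespace Representation

variable {X : Type*} {δ : Representation X}

theorem funNames_associate {E : List ℕ → List ℕ → Bool} {p : ℕ → ℕ} {A : Set X}
    (h : ∀ s x, δ.Names s x → (x ∉ A ↔ ∃ n, E (pre p n) (pre s n) = true)) :
    FunNames δ sierpinski (associate E p) (coChar A) := by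
  intro s x hs
  refine ⟨fun n => if E (pre p n) (pre s n) then 1 else 0, fun n => ⟨n, ?_, fun m hm => ?_⟩, ?_⟩
  · simp only [associate, query_encode, length_pre, lt_irrefl, if_false]
    split_ifs <;> rfl
  · simp only [associate, query_encode, length_pre, hm, if_true]
  · show coChar A x = false ↔ _
    have := h s x hs
    by_cases hx : x ∈ A <;> simp_all [coChar]

theorem isClosed_of_funNames {p : ℕ → ℕ} {A : Set X}
    (h : FunNames δ sierpinski p (coChar A)) : IsClosed[δ.finalTopology] A := by
  rw [← @isOpen_compl_iff _ _ δ.finalTopology, finalTopology, isOpen_coinduced, isOpen_iff_mem_nhds]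
  rintro ⟨q, hq⟩ hqA
  have hqx : δ.Names q hq.choose := hq.choose_spec
  obtain ⟨r, hr, hr'⟩ := h q _ hqx
  have hx : hq.choose ∉ A := hqA
  have hne : ¬ ∀ n, r n = 0 := fun h0 => by
    have := hr'.2 h0
    simp [coChar, hx] at this
  push Not at hne
  obtain ⟨n, hn⟩ := hne
  obtain ⟨m, h1, h2⟩ := hr n
  have hopen : IsOpen {t : ℕ → ℕ | ∀ i ∈ Finset.range m, t i = q i} := by
    have : {t : ℕ → ℕ | ∀ i ∈ Finset.range m, t i = q i} =
        (Finset.range m : Set ℕ).pi fun i => {q i} := by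
      ext t; simp [Set.mem_pi]
    rw [this]
    exact isOpen_set_pi (Finset.finite_toSet _) fun i _ => isOpen_discrete _
  refine Filter.mem_of_superset
    ((hopen.preimage continuous_subtype_val).mem_nhds (by simp)) ?_
  rintro ⟨t, ht⟩ htq
  have htx : δ.Names t ht.choose := ht.choose_spec
  obtain ⟨r', hr1, hr2⟩ := h t _ htx
  show ht.choose ∉ A
  intro htA
  have h0 : ∀ n, r' n = 0 := hr2.1 (by simp [coChar, htA])
  obtain ⟨m', g1, g2⟩ := hr1 n
  have hpre : ∀ k ≤ m, pre t k = pre q k := fun k hk =>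
    pre_congr fun i hi => htq i (Finset.mem_range.2 (by omega))
  rw [h0] at g1
  rcases lt_trichotomy m m' with hlt | rfl | hlt
  · have := g2 m hlt
    rw [hpre m le_rfl, h1] at this
    omega
  · rw [hpre m le_rfl, h1] at g1
    omega
  · have := h2 m' hlt
    rw [← hpre m' hlt.le, g1] at this
    omega

/-- The prefix `v` of an associate shows on a prefix `w` of an argument that the value is not the
zero sequence. -/
def Rejects (v w : List ℕ) : Prop :=
  ∃ n, n < v.length ∧ ∃ m, m < w.length + 1 ∧
    2 ≤ v[Encodable.encode (n, w.take m)]?.getD 0 ∧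
      ¬ ∃ m', m' < m ∧ v[Encodable.encode (n, w.take m')]? ≠ some 0

@[fun_prop] theorem primrecPred_rejects :
    PrimrecPred fun z : List ℕ × List ℕ => Rejects z.1 z.2 := by
  unfold Rejects; fun_prop

theorem Rejects.mono {v v' w w' : List ℕ} (hv : v <+: v') (hw : w <+: w') (h : Rejects v w) :
    Rejects v' w' := by
  obtain ⟨n, hn, m, hm, h1, h2⟩ := h
  have ht : ∀ k ≤ m, w'.take k = w.take k := fun k hk => take_of_prefix hw (by omega)
  have hl := hv.length_le
  have hl' := hw.length_le
  have hg : ∀ c a, v[c]? = some a → v'[c]? = some a := fun c a hc => by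
    rw [getElem?_of_prefix hv (List.getElem?_eq_some_iff.1 hc).1, hc]
  refine ⟨n, by omega, m, by omega, ?_, ?_⟩
  · rw [ht m le_rfl]
    rcases hc : v[Encodable.encode (n, w.take m)]? with _ | a
    · rw [hc] at h1; simp at h1
    · rw [hg _ _ hc]; rw [hc] at h1; exact h1
  · rintro ⟨m', hm', hne⟩
    refine hne ?_
    rw [ht m' hm'.le]
    refine hg _ _ ?_
    by_contra hc
    exact h2 ⟨m', hm', hc⟩

theorem not_mem_of_rejects {p s : ℕ → ℕ} {x : X} {A : Set X}
    (hp : FunNames δ sierpinski p (coChar A)) (hs : δ.Names s x) {t t' : ℕ}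
    (h : Rejects (pre p t) (pre s t')) : x ∉ A := by
  intro hx
  obtain ⟨r, hr, hr'⟩ := hp s x hs
  have h0 : ∀ n, r n = 0 := hr'.1 (by simp [coChar, hx])
  obtain ⟨n, -, m, hm, h1, h2⟩ := h
  obtain ⟨k, g1, g2⟩ := hr n
  rw [h0] at g1
  simp only [length_pre] at hm
  have ht : ∀ k ≤ m, (pre s t').take k = pre s k := fun k hk => take_pre_of_le s (by omega)
  have hval : 2 ≤ p (Encodable.encode (n, pre s m)) := by
    rw [ht m le_rfl] at h1
    rcases hc : (pre p t)[Encodable.encode (n, pre s m)]? with _ | a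
    · rw [hc] at h1; simp at h1
    · rw [hc] at h1
      rw [(getElem?_pre_eq_some.1 hc).2]
      exact h1
  rcases lt_trichotomy k m with hlt | rfl | hlt
  · refine h2 ⟨k, hlt, fun hc => ?_⟩
    rw [ht k hlt.le] at hc
    have := (getElem?_pre_eq_some.1 hc).2
    omega
  · omega
  · have := g2 m hlt
    omega

theorem rejects_of_not_mem {p s : ℕ → ℕ} {x : X} {A : Set X}
    (hp : FunNames δ sierpinski p (coChar A)) (hs : δ.Names s x) (hx : x ∉ A) :
    ∃ T, ∀ t t', T ≤ t → T ≤ t' → Rejects (pre p t) (pre s t') := by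
  obtain ⟨r, hr, hr'⟩ := hp s x hs
  have hne : ¬ ∀ n, r n = 0 := fun h0 => by
    have := hr'.2 h0
    simp [coChar, hx] at this
  push Not at hne
  obtain ⟨n, hn⟩ := hne
  obtain ⟨m, h1, h2⟩ := hr n
  obtain ⟨M, hM⟩ : ∃ M, ∀ k, k ≤ m → Encodable.encode (n, pre s k) < M := by
    refine ⟨(Finset.range (m + 1)).sup (fun k => Encodable.encode (n, pre s k)) + 1, fun k hk => ?_⟩
    exact Nat.lt_succ_of_le (Finset.le_sup (f := fun k => Encodable.encode (n, pre s k))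
      (Finset.mem_range.2 (by omega)))
  refine ⟨max M (max (n + 1) (m + 1)), fun t t' ht ht' => ⟨n, by simp; omega, m, by simp; omega,
    ?_, ?_⟩⟩
  · rw [take_pre_of_le s (by omega), getElem?_pre p (by have := hM m le_rfl; omega), h1]
    simp only [Option.getD_some]
    omega
  · rintro ⟨m', hm', hne⟩
    refine hne ?_
    rw [take_pre_of_le s (by omega), getElem?_pre p (by have := hM m' hm'.le; omega), h2 m' hm']

end Representation

theorem computableFun_id : ComputableFun fun p => Part.some p :=
  ⟨id, Computable.id, fun _ _ h => h, fun p q hq k => by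
    obtain rfl := Part.mem_some_iff.1 hq
    exact ⟨k, List.prefix_rfl⟩⟩

namespace MultiFun

theorem mem_dom_posChoice {X : Type u} [MeasurableSpace X] {δ : Representation X} {μ : Measure X}
    {A : δ.Closeds} : A ∈ (posChoice δ μ).dom ↔ 0 < μ A.1 := by
  constructor
  · rintro ⟨x, hx⟩
    exact hx.2.1
  · intro h
    obtain ⟨x, hx⟩ := nonempty_of_measure_ne_zero h.ne'
    exact ⟨x, hx, h, le_top⟩

/-! ### From trees to closed subsets of Cantor space -/

/-- The `i`-th component of a sequence of sequences. -/
def column (p : ℕ → ℕ) (i : ℕ) : ℕ → ℕ := fun j => p (Nat.pair i j)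

/-- The prefix of length `n` of the `i`-th component, read off from a prefix. -/
def columnWord (v : List ℕ) (i n : ℕ) : List ℕ :=
  (List.range n).map fun t => v[Nat.pair i t]?.getD 0

@[fun_prop] theorem primrec_columnWord :
    Primrec fun z : List ℕ × ℕ × ℕ => columnWord z.1 z.2.1 z.2.2 := by
  unfold columnWord; fun_prop

theorem columnWord_pre (p : ℕ → ℕ) {i n m : ℕ} (h : Nat.pair i n ≤ m) :
    columnWord (pre p m) i n = pre (column p i) n := by
  refine List.map_congr_left fun t ht => ?_
  rw [getElem?_pre p ((Nat.pair_lt_pair_right i (List.mem_range.1 ht)).trans_le h)]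
  rfl

theorem computableFun_associate_column {E : List ℕ → List ℕ → Bool}
    (hE : Primrec fun z : List ℕ × List ℕ => E z.1 z.2) :
    ComputableFun fun p => Part.some fun c => associate E (column p c.unpair.1) c.unpair.2 := by
  refine computableFun_of_bounded
    (b := fun c => Nat.pair c.unpair.1 (query c.unpair.2).1)
    (G := fun v c => if (query c.unpair.2).2.length < (query c.unpair.2).1 then 0 else
      if E (columnWord v c.unpair.1 (query c.unpair.2).1) (query c.unpair.2).2 = true then 2 else 1)
    ?_ (by fun_prop) ?_
  · refine Primrec.to_comp ?_
    fun_prop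
  · intro p c
    simp only [associate, columnWord_pre p le_rfl]

/-- A finite word over the naturals as a binary word. -/
def toBools (u : List ℕ) : List Bool := u.map fun a => decide (a ≠ 0)

@[fun_prop] theorem primrec_toBools : Primrec toBools := by unfold toBools; fun_prop

theorem toBools_pre_bits (x : ℕ → Bool) (n : ℕ) :
    toBools (pre (Representation.bits x) n) = (List.range n).map x := by
  simp only [toBools, pre, List.map_map]
  refine List.map_congr_left fun i _ => ?_
  cases h : x i <;> simp [Representation.bits, h]

/-- A prefix of the characteristic function of a tree shows that the tree contains no extension
of the word `u`. -/
def LeavesTree (v u : List ℕ) : Prop :=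
  ∃ m, m < u.length + 1 ∧ v[Encodable.encode (toBools (u.take m))]?.getD 1 ≠ 1

theorem primrecPred_leavesTree : PrimrecPred fun z : List ℕ × List ℕ => LeavesTree z.1 z.2 := by
  unfold LeavesTree; fun_prop

theorem wwkl_jump_le : LeSW WWKL.discreteJump PCCantor.discreteJump := by
  classical
  refine leSW_of_total (H := fun p => Part.some p)
    (computableFun_associate_column (E := fun v u => decide (LeavesTree v u))
      primrecPred_leavesTree.decide) computableFun_id ?_
  rintro p T ⟨q, ⟨N, hN⟩, hq⟩ hT
  have hname : Representation.FunNames Representation.cantor Representation.sierpinski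
      (associate (fun v u => decide (LeavesTree v u)) q) (Representation.coChar T.paths) := by
    refine Representation.funNames_associate ?_
    rintro s x rfl
    simp only [decide_eq_true_eq]
    constructor
    · intro hx
      simp only [BinTree.paths, Set.mem_ofPred_eq, not_forall] at hx
      obtain ⟨m, hm⟩ := hx
      refine ⟨max (m + 1) (Encodable.encode ((List.range m).map x) + 1), m,
        by simp only [length_pre]; omega, ?_⟩
      rw [take_pre_of_le _ (by omega), toBools_pre_bits, getElem?_pre q (by omega),
        (hq _).2 hm]
      simp
    · rintro ⟨n, m, hm, hne⟩ hx
      simp only [length_pre] at hm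
      rw [take_pre_of_le _ (by omega), toBools_pre_bits] at hne
      rcases hc : (pre q n)[Encodable.encode ((List.range m).map x)]? with _ | a
      · simp [hc] at hne
      · rw [hc] at hne
        have h1 := (getElem?_pre_eq_some.1 hc).2
        rw [(hq _).1 (hx m)] at h1
        exact hne h1.symm
  have hpos : 0 < cantorMeasure T.paths := by
    obtain ⟨x, hx⟩ := hT
    exact hx.2
  refine ⟨⟨T.paths, Representation.isClosed_of_funNames hname⟩, ⟨_, ⟨N, fun i hi j => ?_⟩, hname⟩,
    mem_dom_posChoice.2 hpos, ?_⟩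
  · simp only [Nat.unpair_pair]
    congr 1
    funext t
    exact hN i hi t
  · intro s y hy hs
    exact ⟨s, Part.mem_some _, y, ⟨hy.1, hpos⟩, hs⟩

/-! ### From discrete limits to `ℕ × 2^ℕ` -/

/-- The word `k w` is refuted by a prefix of a sequence of names: the sequence changes after
position `k`, or the `k`-th name rejects `w`. -/
def RefutedColumn (v u : List ℕ) : Prop :=
  (∃ i, i < v.length ∧ ∃ j, j < v.length ∧ u[0]?.getD 0 ≤ i ∧ Nat.pair i j < v.length ∧
    Nat.pair (u[0]?.getD 0) j < v.length ∧ v[Nat.pair i j]? ≠ v[Nat.pair (u[0]?.getD 0) j]?) ∨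
  ∃ m, m < v.length ∧ Nat.pair (u[0]?.getD 0) m ≤ v.length ∧
    Representation.Rejects (columnWord v (u[0]?.getD 0) m) u.tail

theorem primrecPred_refutedColumn :
    PrimrecPred fun z : List ℕ × List ℕ => RefutedColumn z.1 z.2 := by
  unfold RefutedColumn; fun_prop

theorem natCantorMeasure_singleton_prod (k : ℕ) (A : Set (ℕ → Bool)) :
    natCantorMeasure ({k} ×ˢ A) = cantorMeasure A := by
  have : IsProbabilityMeasure cantorMeasure := by unfold cantorMeasure; infer_instance
  rw [natCantorMeasure, Measure.prod_prod, Measure.count_singleton, one_mul]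

theorem computableFun_tail : ComputableFun fun p => Part.some fun n => p (n + 1) := by
  refine computableFun_of_bounded (b := fun n => n + 2) (G := fun v n => v[n + 1]?.getD 0)
    (Primrec.to_comp (by fun_prop)) (by fun_prop) fun p n => ?_
  rw [getElem?_pre p (by omega)]
  rfl

theorem pcCantor_jump_le : LeSW PCCantor.discreteJump PCNatCantor := by
  classical
  refine leSW_of_total (computableFun_associate (E := fun v u => decide (RefutedColumn v u))
      primrecPred_refutedColumn.decide.to_comp) computableFun_tail ?_
  rintro p A ⟨q, ⟨N, hN⟩, hq⟩ hA
  have hq' : Representation.FunNames Representation.cantor Representation.sierpinski q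
    (Representation.coChar A.1) := hq
  set B : Set (ℕ × (ℕ → Bool)) :=
    {a | (∀ i, a.1 ≤ i → ∀ j, p (Nat.pair i j) = p (Nat.pair a.1 j)) ∧ a.2 ∈ A.1} with hB
  have hstable : ∀ k, (∀ i, k ≤ i → ∀ j, p (Nat.pair i j) = p (Nat.pair k j)) →
      column p k = q := by
    intro k hk
    funext j
    rw [← hN (max k N) (le_max_right _ _) j, hk _ (le_max_left _ _) j, column]
  have hname : Representation.FunNames Representation.natCantor Representation.sierpinski
      (associate (fun v u => decide (RefutedColumn v u)) p) (Representation.coChar B) := by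
    refine Representation.funNames_associate ?_
    rintro s ⟨k, x⟩ rfl
    have hpre : ∀ n, pre (Representation.natBits (k, x)) (n + 1) =
        k :: pre (Representation.bits x) n := fun n => pre_consSeq _ _ _
    simp only [decide_eq_true_eq]
    constructor
    · intro hx
      by_cases hk : ∀ i, k ≤ i → ∀ j, p (Nat.pair i j) = p (Nat.pair k j)
      · have hxA : x ∉ A.1 := fun h => hx ⟨hk, h⟩
        obtain ⟨T, hT⟩ := Representation.rejects_of_not_mem hq'
          (show Representation.cantor.Names (Representation.bits x) x from rfl) hxA
        refine ⟨Nat.pair k T + T + 1, Or.inr ⟨T, by simp only [length_pre]; omega, ?_, ?_⟩⟩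
        · simp only [hpre, length_pre]
          simp only [List.getElem?_cons_zero, Option.getD_some]
          omega
        · simp only [hpre, List.getElem?_cons_zero, Option.getD_some, List.tail_cons]
          rw [columnWord_pre p (by omega), hstable k hk]
          exact hT _ _ le_rfl (by omega)
      · push Not at hk
        obtain ⟨i, hki, j, hij⟩ := hk
        refine ⟨Nat.pair i j + Nat.pair k j + i + j + 1, Or.inl
          ⟨i, by simp only [length_pre]; omega, j, by simp only [length_pre]; omega, ?_⟩⟩
        simp only [hpre, List.getElem?_cons_zero, Option.getD_some, length_pre]
        refine ⟨hki, by omega, by omega, ?_⟩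
        rw [getElem?_pre p (by omega), getElem?_pre p (by omega)]
        simpa using hij
    · rintro ⟨n, hn⟩ ⟨hk, hx⟩
      simp only at hk hx
      rcases n with _ | n
      · simp [RefutedColumn] at hn
      rcases hn with ⟨i, -, j, -, hn⟩ | ⟨m, -, hn⟩
      · simp only [hpre, List.getElem?_cons_zero, Option.getD_some, length_pre] at hn
        obtain ⟨h1, h2, h3, h4⟩ := hn
        rw [getElem?_pre p h2, getElem?_pre p h3, hk i h1 j] at h4
        exact h4 rfl
      · simp only [hpre, List.getElem?_cons_zero, Option.getD_some, length_pre,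
          List.tail_cons] at hn
        rw [columnWord_pre p hn.1, hstable k hk] at hn
        exact Representation.not_mem_of_rejects hq'
          (show Representation.cantor.Names (Representation.bits x) x from rfl) hn.2 hx
  have hpos : 0 < natCantorMeasure B := by
    have h1 : 0 < cantorMeasure A.1 := by
      obtain ⟨x, hx⟩ := hA
      exact hx.2.1
    rw [← natCantorMeasure_singleton_prod N] at h1
    refine h1.trans_le (measure_mono ?_)
    rintro ⟨k, x⟩ ⟨hk, hx⟩
    obtain rfl : k = N := hk
    exact ⟨fun i hi j => (hN i hi j).trans (hN k le_rfl j).symm, hx⟩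
  refine ⟨⟨B, Representation.isClosed_of_funNames hname⟩, hname, mem_dom_posChoice.2 hpos, ?_⟩
  rintro s ⟨k, x⟩ hy rfl
  refine ⟨_, Part.mem_some _, x, ⟨hy.1.2, ?_⟩, rfl⟩
  obtain ⟨y, hy⟩ := hA
  exact hy.2

/-! ### Las Vegas computability and choice on `ℕ × 2^ℕ` -/

theorem LasVegasFMC.leW {f : MultiFun.{u, v}} (hf : LasVegasFMC f) : LeW f PCNatCantor := by
  classical
  obtain ⟨F₁, F₂, hF₁, ⟨φ, c, mono, a⟩, h⟩ := hf
  set E : List ℕ → List ℕ → Bool := fun v u =>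
    decide (∃ i, i < (φ (pairWord v u)).length ∧ (φ (pairWord v u))[i]?.getD 0 ≠ 0) with hE
  have hEc : Computable fun z : List ℕ × List ℕ => E z.1 z.2 := by
    have h1 : Primrec fun l : List ℕ => decide (∃ i, i < l.length ∧ l[i]?.getD 0 ≠ 0) := by
      fun_prop
    exact h1.to_comp.comp (c.comp primrec_pairWord.to_comp)
  refine ⟨_, F₁, computableFun_associate hEc, hF₁, fun G hG p x hp hx => ?_⟩
  obtain ⟨hdom, -, hpos, hval⟩ := h p x hp hx
  set B : Set (ℕ × (ℕ → Bool)) :=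
    toBaire ⁻¹' successSet (Set.range Representation.natBits) F₂ p with hB
  have hname : Representation.FunNames Representation.natCantor Representation.sierpinski
      (associate E p) (Representation.coChar B) := by
    refine Representation.funNames_associate ?_
    rintro s r rfl
    have hd := hdom (Representation.natBits r) ⟨r, rfl⟩
    obtain ⟨t, ht⟩ := Part.dom_iff_mem.1 hd
    have hmem : r ∈ B ↔ ∀ n, t n = 0 := by
      constructor
      · rintro ⟨t', ht', h0⟩
        rw [Part.mem_unique ht ht']
        exact h0.1 rfl
      · intro h0
        exact ⟨t, ht, by simp [Representation.sierpinski, h0]⟩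
    rw [hmem]
    have hpr := fun n => pre_of_computableFun mono a ht n
    simp only [hE, decide_eq_true_eq, pairWord_pre, min_self]
    constructor
    · intro hne
      push Not at hne
      obtain ⟨i, hi⟩ := hne
      obtain ⟨n, hn⟩ := a _ _ ht (i + 1)
      have hn' := hn.trans (mono _ _ (pre_prefix _ (show n ≤ 2 * n by omega)))
      have hl := hn'.length_le
      simp only [length_pre] at hl
      refine ⟨n, i, by omega, ?_⟩
      rw [hpr, getElem?_pre t (by omega)]
      exact hi
    · rintro ⟨n, i, hi, hne⟩ h0
      rw [hpr, getElem?_pre t hi, h0] at hne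
      exact hne rfl
  have hemb : MeasurableEmbedding toBaire :=
    measurable_toBaire.measurableEmbedding fun a b hab =>
      Representation.natBits_injective (congrArg Subtype.val hab)
  have hBpos : 0 < natCantorMeasure B := by
    rw [hB, ← hemb.map_apply]
    exact hpos.1
  obtain ⟨q, hq, r, hr, hqr⟩ := hG _ ⟨B, Representation.isClosed_of_funNames hname⟩ hname
    (mem_dom_posChoice.2 hBpos)
  obtain rfl : q = Representation.natBits r := hqr
  obtain ⟨z, hz, hy⟩ := hval (toBaire r) hr.1
  exact ⟨z, Part.mem_bind_iff.2 ⟨_, Part.mem_some _, Part.mem_bind_iff.2 ⟨_, hq, hz⟩⟩, hy⟩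

/-- The value at `n` of the function coded by an associate with prefix `a` on an argument with
prefix `b`, as far as it is determined. -/
def evalWord (a b : List ℕ) (n : ℕ) : Option ℕ :=
  if a[Encodable.encode (n, b.take ((List.range (b.length + 1)).findIdx fun m =>
      decide (a[Encodable.encode (n, b.take m)]? ≠ some 0)))]?.getD 0 = 0 then none
  else some (a[Encodable.encode (n, b.take ((List.range (b.length + 1)).findIdx fun m =>
      decide (a[Encodable.encode (n, b.take m)]? ≠ some 0)))]?.getD 0 - 1)

@[fun_prop] theorem primrec_evalWord :
    Primrec fun z : List ℕ × List ℕ × ℕ => evalWord z.1 z.2.1 z.2.2 := by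
  unfold evalWord; fun_prop

theorem evalWord_of_first {a b : List ℕ} {n m c : ℕ} (hm : m ≤ b.length)
    (h : a[Encodable.encode (n, b.take m)]? = some (c + 1))
    (h0 : ∀ m' < m, a[Encodable.encode (n, b.take m')]? = some 0) : evalWord a b n = some c := by
  have hf : ((List.range (b.length + 1)).findIdx fun m =>
      decide (a[Encodable.encode (n, b.take m)]? ≠ some 0)) = m := by
    rw [List.findIdx_eq (by rw [List.length_range]; omega)]
    simp only [List.getElem_range, h]
    refine ⟨by simp, fun j hj => by rw [h0 j hj]; simp⟩
  simp only [evalWord, hf, h]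
  simp

theorem first_of_evalWord {a b : List ℕ} {n c : ℕ} (h : evalWord a b n = some c) :
    ∃ m ≤ b.length, a[Encodable.encode (n, b.take m)]? = some (c + 1) ∧
      ∀ m' < m, a[Encodable.encode (n, b.take m')]? = some 0 := by
  set m := (List.range (b.length + 1)).findIdx fun m =>
      decide (a[Encodable.encode (n, b.take m)]? ≠ some 0) with hm
  simp only [evalWord, ← hm] at h
  split_ifs at h with hc
  have h0 : ∀ m' < m, a[Encodable.encode (n, b.take m')]? = some 0 := by
    intro m' hm'
    have := List.not_of_lt_findIdx hm'
    simpa using this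
  have hsome : a[Encodable.encode (n, b.take m)]? = some (c + 1) := by
    rcases hv : a[Encodable.encode (n, b.take m)]? with _ | d
    · rw [hv] at hc; simp at hc
    · rw [hv] at hc h
      simp only [Option.getD_some, Option.some.injEq] at hc h
      congr 1
      omega
  refine ⟨m, ?_, hsome, h0⟩
  by_contra hlt
  have h1 := h0 b.length (by omega)
  rw [List.take_of_length_le (by omega)] at hsome
  rw [List.take_of_length_le le_rfl, hsome] at h1
  simp at h1

theorem exists_realizer (g : MultiFun.{u, v}) (r : (ℕ → ℕ) → (ℕ → ℕ))
    (hr : ∀ p x, g.inRep.Names p x → x ∈ g.dom → ∃ y ∈ g.val x, g.outRep.Names (r p) y) :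
    ∃ G : (ℕ → ℕ) →. (ℕ → ℕ), Realizes G g ∧
      ∀ p, ∀ q ∈ G p, q = r p ∧ ∃ x ∈ g.dom, g.inRep.Names p x := by
  refine ⟨fun p => ⟨∃ x ∈ g.dom, g.inRep.Names p x, fun _ => r p⟩, fun p x hp hx => ?_, ?_⟩
  · exact ⟨r p, ⟨⟨x, hx, hp⟩, rfl⟩, hr p x hp hx⟩
  · rintro p q ⟨h, rfl⟩
    exact ⟨rfl, h⟩

theorem lasVegasFMC_of_leW {f : MultiFun.{u, v}} (hf : LeW f PCNatCantor) : LasVegasFMC f := by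
  classical
  obtain ⟨K, H, ⟨φ, c, mono, a⟩, hH, h⟩ := hf
  have huniq : ∀ s t t', (∃ k ∈ K (fstSeq s), Applies k (sndSeq s) t) →
      (∃ k ∈ K (fstSeq s), Applies k (sndSeq s) t') → t = t' := by
    rintro s t t' ⟨k, hk, ht⟩ ⟨k', hk', ht'⟩
    obtain rfl := Part.mem_unique hk hk'
    exact Representation.applies_unique ht ht'
  set F₂ : (ℕ → ℕ) →. (ℕ → ℕ) := fun s =>
    ⟨∃ t, ∃ k ∈ K (fstSeq s), Applies k (sndSeq s) t, fun h => h.choose⟩ with hF₂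
  have hmem : ∀ s t, t ∈ F₂ s ↔ ∃ k ∈ K (fstSeq s), Applies k (sndSeq s) t := by
    intro s t
    constructor
    · rintro ⟨hd, rfl⟩
      exact hd.choose_spec
    · intro ht
      exact ⟨⟨t, ht⟩, huniq s _ _ (Exists.choose_spec
        (⟨t, ht⟩ : ∃ t, ∃ k ∈ K (fstSeq s), Applies k (sndSeq s) t)) ht⟩
  have base : ∀ k A, PCNatCantor.inRep.Names k A → A ∈ PCNatCantor.dom →
      ∃ q, ∃ y ∈ PCNatCantor.val A, PCNatCantor.outRep.Names q y := by
    rintro k A - ⟨y, hy⟩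
    obtain ⟨q, hq⟩ := PCNatCantor.outRep.surj y
    exact ⟨q, y, hy, hq⟩
  set r₀ : (ℕ → ℕ) → (ℕ → ℕ) := fun k =>
    if hk : ∃ A ∈ PCNatCantor.dom, PCNatCantor.inRep.Names k A then
      (base k _ hk.choose_spec.2 hk.choose_spec.1).choose else k with hr₀
  have hr₀' : ∀ k A, PCNatCantor.inRep.Names k A → A ∈ PCNatCantor.dom →
      ∃ y ∈ PCNatCantor.val A, PCNatCantor.outRep.Names (r₀ k) y := by
    intro k A hk hA
    have hex : ∃ A ∈ PCNatCantor.dom, PCNatCantor.inRep.Names k A := ⟨A, hA, hk⟩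
    obtain rfl : hex.choose = A := PCNatCantor.inRep.unique hex.choose_spec.2 hk
    simp only [hr₀, dif_pos hex]
    exact (base k _ hex.choose_spec.2 hex.choose_spec.1).choose_spec
  refine ⟨H, F₂, hH, ?_, ?_⟩
  · refine computableFun_of_step (g := fun v n => evalWord (φ (fstWord v)) (sndWord v) n) ?_ ?_
    · have h1 : Computable fun z : List ℕ × ℕ => (φ (fstWord z.1), sndWord z.1, z.2) :=
        (c.comp (primrec_fstWord.to_comp.comp Computable.fst)).pair
          ((primrec_sndWord.to_comp.comp Computable.fst).pair Computable.snd)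
      exact primrec_evalWord.to_comp.comp h1
    · intro s t ht
      obtain ⟨k, hk, ht⟩ := (hmem s t).1 ht
      have hpr := fun n => pre_of_computableFun mono a hk n
      constructor
      · intro m n d hd
        simp only [fstWord_pre, sndWord_pre] at hd
        obtain ⟨i, hi, h1, h2⟩ := first_of_evalWord hd
        simp only [length_pre] at hi
        obtain ⟨j, g1, g2⟩ := ht n
        rw [take_pre_of_le _ hi, hpr] at h1
        have h1' := (getElem?_pre_eq_some.1 h1).2
        have h2' : ∀ m' < i, k (Encodable.encode (n, pre (sndSeq s) m')) = 0 := by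
          intro m' hm'
          have := h2 m' hm'
          rw [take_pre_of_le _ (by omega), hpr] at this
          exact (getElem?_pre_eq_some.1 this).2
        rcases lt_trichotomy i j with hij | rfl | hij
        · have := g2 i hij; omega
        · omega
        · have := h2' j hij; omega
      · intro n
        obtain ⟨j, g1, g2⟩ := ht n
        set M := (Finset.range (j + 1)).sup
          (fun i => Encodable.encode (n, pre (sndSeq s) i)) with hM
        have hle : ∀ i ≤ j, Encodable.encode (n, pre (sndSeq s) i) ≤ M := fun i hi =>
          Finset.le_sup (f := fun i => Encodable.encode (n, pre (sndSeq s) i))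
            (Finset.mem_range.2 (by omega))
        obtain ⟨N, hN⟩ := a _ _ hk (M + 1)
        refine ⟨2 * max N j, fun m hm => ?_⟩
        have hlen : M + 1 ≤ (φ (pre (fstSeq s) (m / 2))).length := by
          have := (hN.trans (mono _ _ (pre_prefix _ (show N ≤ m / 2 by omega)))).length_le
          simpa using this
        simp only [fstWord_pre, sndWord_pre]
        rw [evalWord_of_first (m := j) (c := t n)]
        · simp
        · simp only [length_pre]; omega
        · have := hle j le_rfl
          rw [take_pre_of_le _ (by omega), hpr, getElem?_pre k (by omega), g1]
        · intro m' hm'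
          have := hle m' hm'.le
          rw [take_pre_of_le _ (by omega), hpr, getElem?_pre k (by omega), g2 m' hm']
  · intro p x hp hx
    obtain ⟨G₀, hG₀, hG₀'⟩ := exists_realizer PCNatCantor r₀ hr₀'
    obtain ⟨z, hz, -⟩ := h G₀ hG₀ p x hp hx
    obtain ⟨k, hk, hz⟩ := Part.mem_bind_iff.1 hz
    obtain ⟨q, hq, -⟩ := Part.mem_bind_iff.1 hz
    obtain ⟨-, A, hA, hkA⟩ := hG₀' k q hq
    have hkA' : Representation.FunNames Representation.natCantor Representation.sierpinski k
      (Representation.coChar A.1) := hkA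
    have hsucc : ∀ b, toBaire b ∈ successSet (Set.range Representation.natBits) F₂ p ↔
        b ∈ A.1 := by
      intro b
      obtain ⟨t, ht, ht'⟩ := hkA' (Representation.natBits b) b rfl
      have htF : t ∈ F₂ (pairSeq p (Representation.natBits b)) :=
        (hmem _ _).2 ⟨k, by simpa using hk, by simpa using ht⟩
      constructor
      · rintro ⟨t', h1, h2⟩
        obtain rfl := Part.mem_unique htF h1
        have := Representation.sierpinski.unique ht' h2
        by_contra hb
        simp [Representation.coChar, hb] at this
      · intro hb
        refine ⟨t, htF, ?_⟩
        have : Representation.coChar A.1 b = false := by simp [Representation.coChar, hb]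
        rwa [this] at ht'
    have hApos : 0 < natCantorMeasure A.1 := mem_dom_posChoice.1 hA
    have hpre : toBaire ⁻¹' successSet (Set.range Representation.natBits) F₂ p = A.1 :=
      Set.ext hsucc
    refine ⟨?_, ?_, ⟨?_, le_top⟩, ?_⟩
    · rintro _ ⟨b, rfl⟩
      obtain ⟨t, ht, -⟩ := hkA' (Representation.natBits b) b rfl
      exact Part.dom_iff_mem.2 ⟨t, (hmem _ _).2 ⟨k, by simpa using hk, by simpa using ht⟩⟩
    · obtain ⟨b, hb⟩ := nonempty_of_measure_ne_zero hApos.ne'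
      exact ⟨toBaire b, (hsucc b).2 hb⟩
    · refine hApos.trans_le ?_
      rw [← hpre]
      exact Measure.le_map_apply measurable_toBaire.aemeasurable _
    · rintro ⟨_, b, rfl⟩ hb
      have hbA : b ∈ A.1 := (hsucc b).1 hb
      obtain ⟨G, hG, hG'⟩ := exists_realizer PCNatCantor
        (fun k' => if k' = k then Representation.natBits b else r₀ k') (by
          intro k' A' hk' hA'
          by_cases hkk : k' = k
          · subst hkk
            obtain rfl := PCNatCantor.inRep.unique hkA hk'
            simp only [if_true]
            exact ⟨b, ⟨hbA, hApos, le_top⟩, rfl⟩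
          · simp only [if_neg hkk]
            exact hr₀' k' A' hk' hA')
      obtain ⟨z, hz, hy⟩ := h G hG p x hp hx
      obtain ⟨k', hk', hz⟩ := Part.mem_bind_iff.1 hz
      obtain rfl := Part.mem_unique hk hk'
      obtain ⟨q, hq, hz⟩ := Part.mem_bind_iff.1 hz
      obtain ⟨rfl, -⟩ := hG' _ _ hq
      simp only [if_true] at hz
      exact ⟨z, hz, hy⟩

/-! ### The uniform measure on Cantor space -/

instance isProbabilityMeasure_cantorMeasure : IsProbabilityMeasure cantorMeasure := by
  unfold cantorMeasure; infer_instance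

/-- The number with binary expansion `x 0, …, x (n - 1)`, most significant digit first. -/
def binVal (x : ℕ → Bool) : ℕ → ℕ
  | 0 => 0
  | n + 1 => 2 * binVal x n + (x n).toNat

theorem binVal_lt (x : ℕ → Bool) (n : ℕ) : binVal x n < 2 ^ n := by
  induction n with
  | zero => simp [binVal]
  | succ n ih =>
    have := Bool.toNat_le (x n)
    rw [binVal, pow_succ]
    omega

theorem binVal_eq_iff {x : ℕ → Bool} {n t : ℕ} (ht : t < 2 ^ n) :
    binVal x n = t ↔ ∀ i < n, x i = t.testBit (n - 1 - i) := by
  induction n generalizing t with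
  | zero =>
    rw [pow_zero] at ht
    simp [binVal]
    omega
  | succ n ih =>
    have h2 : t / 2 < 2 ^ n := by rw [pow_succ] at ht; omega
    have h1 : binVal x (n + 1) = t ↔ binVal x n = t / 2 ∧ x n = t.testBit 0 := by
      rw [binVal, Nat.testBit_zero]
      rcases hx : x n <;> simp [] <;> omega
    rw [h1, ih h2]
    constructor
    · rintro ⟨h, h'⟩ i hi
      rcases Nat.lt_succ_iff_lt_or_eq.1 hi with hi | rfl
      · rw [h i hi, Nat.testBit_div_two]
        congr 1
        omega
      · rw [h']
        congr 1
        omega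
    · intro h
      refine ⟨fun i hi => ?_, ?_⟩
      · rw [h i (by omega), Nat.testBit_div_two]
        congr 1
        omega
      · rw [h n (by omega)]
        congr 1
        omega

theorem binVal_add (x : ℕ → Bool) (m n : ℕ) :
    binVal x (m + n) = binVal x m * 2 ^ n + binVal (fun i => x (m + i)) n := by
  induction n with
  | zero => simp [binVal]
  | succ n ih => rw [← add_assoc, binVal, ih, binVal, pow_succ]; ring

theorem setOf_binVal_eq {n t : ℕ} (ht : t < 2 ^ n) :
    {x | binVal x n = t} =
      Set.pi (Finset.range n : Set ℕ) fun i => {t.testBit (n - 1 - i)} := by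
  ext x
  simp [binVal_eq_iff ht, Set.mem_pi]

theorem measurableSet_binVal_eq (n t : ℕ) : MeasurableSet {x | binVal x n = t} := by
  by_cases ht : t < 2 ^ n
  · rw [setOf_binVal_eq ht]
    exact MeasurableSet.pi (Finset.countable_toSet _) fun i _ => measurableSet_singleton _
  · have : {x | binVal x n = t} = ∅ := by
      ext x
      have := binVal_lt x n
      simp only [Set.mem_ofPred_eq, Set.mem_empty_iff_false, iff_false]
      omega
    rw [this]
    exact MeasurableSet.empty

theorem cantorMeasure_binVal_eq {n t : ℕ} (ht : t < 2 ^ n) :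
    cantorMeasure {x | binVal x n = t} = 2⁻¹ ^ n := by
  rw [setOf_binVal_eq ht, cantorMeasure,
    Measure.infinitePi_pi _ fun i _ => measurableSet_singleton _]
  rw [Finset.prod_congr rfl (g := fun _ => (2⁻¹ : ℝ≥0∞))]
  · simp
  · intro i _
    rw [PMF.toMeasure_uniformOfFintype_apply _ (measurableSet_singleton _)]
    simp

theorem setOf_binVal_mem (n : ℕ) (S : Finset ℕ) :
    {x | binVal x n ∈ S} = ⋃ t ∈ S, {x | binVal x n = t} := by
  ext x; simp

theorem measurableSet_binVal_mem (n : ℕ) (S : Finset ℕ) : MeasurableSet {x | binVal x n ∈ S} := by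
  rw [setOf_binVal_mem]
  exact S.measurableSet_biUnion fun t _ => measurableSet_binVal_eq n t

theorem cantorMeasure_binVal_mem {n : ℕ} {S : Finset ℕ} (hS : ∀ t ∈ S, t < 2 ^ n) :
    cantorMeasure {x | binVal x n ∈ S} = S.card * 2⁻¹ ^ n := by
  rw [setOf_binVal_mem, measure_biUnion_finset]
  · rw [Finset.sum_congr rfl fun t ht => cantorMeasure_binVal_eq (hS t ht)]
    simp
  · intro s _ t _ hst
    refine Set.disjoint_left.2 fun x hx hx' => hst ?_
    rw [← show binVal x n = s from hx, show binVal x n = t from hx']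
  · exact fun t _ => measurableSet_binVal_eq n t

/-- The binary word of length `n` with value `t`. -/
def binWord (n t : ℕ) : List ℕ :=
  (List.range n).map fun i => (decide (t / 2 ^ (n - 1 - i) % 2 = 1)).toNat

@[fun_prop] theorem primrec_binWord : Primrec fun z : ℕ × ℕ => binWord z.1 z.2 := by
  unfold binWord; fun_prop

theorem pre_bits_eq_binWord (x : ℕ → Bool) (n : ℕ) :
    pre (Representation.bits x) n = binWord n (binVal x n) := by
  refine List.map_congr_left fun i hi => ?_
  rw [Representation.bits, (binVal_eq_iff (binVal_lt x n)).1 rfl i (List.mem_range.1 hi),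
    Nat.testBit_eq_decide_div_mod_eq]

/-! ### Finding a section of positive measure with finitely many mind changes -/

open Classical in
/-- The words of length `n`, given by their values, that are not yet rejected in section `k`. -/
noncomputable def alive (v : List ℕ) (n k : ℕ) : List ℕ :=
  (List.range (2 ^ n)).filter fun t =>
    decide (¬ Representation.Rejects (v.take n) (k :: binWord n t))

@[fun_prop] theorem primrec_alive :
    Primrec fun z : List ℕ × ℕ × ℕ => alive z.1 z.2.1 z.2.2 := by
  unfold alive; fun_prop

theorem mem_alive {v : List ℕ} {n k t : ℕ} : t ∈ alive v n k ↔
    t < 2 ^ n ∧ ¬ Representation.Rejects (v.take n) (k :: binWord n t) := by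
  simp [alive]

theorem nodup_alive (v : List ℕ) (n k : ℕ) : (alive v n k).Nodup :=
  List.nodup_range.filter _

/-- The guess `⟨k, j⟩`, that section `k` has measure at least `2^(-j)`, is consistent with the
prefix `v` of a name. -/
def Consistent (v : List ℕ) (g : ℕ) : Prop :=
  ¬ ∃ n, n < v.length + 1 ∧ (alive v n g.unpair.1).length * 2 ^ g.unpair.2 < 2 ^ n

@[fun_prop] theorem primrecPred_consistent :
    PrimrecPred fun z : List ℕ × ℕ => Consistent z.1 z.2 := by
  unfold Consistent; fun_prop

open Classical in
/-- The first guess consistent with a prefix of a name. -/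
noncomputable def guess (v : List ℕ) : ℕ :=
  (List.range v.length).findIdx fun g => decide (Consistent v g)

@[fun_prop] theorem primrec_guess : Primrec guess := by unfold guess; fun_prop

theorem alive_pre (p : ℕ → ℕ) {m n : ℕ} (h : n ≤ m) (k : ℕ) :
    alive (pre p m) n k = alive (pre p n) n k := by
  unfold alive
  rw [take_pre_of_le p h, take_pre_of_le p le_rfl]

theorem consistent_pre_iff {p : ℕ → ℕ} {m g : ℕ} : Consistent (pre p m) g ↔
    ∀ n ≤ m, 2 ^ n ≤ (alive (pre p n) n g.unpair.1).length * 2 ^ g.unpair.2 := by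
  simp only [Consistent, length_pre, not_exists, not_and, not_lt]
  refine forall_congr' fun n => ⟨fun h hn => ?_, fun h hn => ?_⟩
  · rw [← alive_pre p hn]
    exact h (by omega)
  · rw [alive_pre p (by omega)]
    exact h (by omega)

theorem guess_converges {p : ℕ → ℕ} (h : ∃ g, ∀ m, Consistent (pre p m) g) :
    ∃ g, (∀ m, Consistent (pre p m) g) ∧ ∃ N, ∀ m, N ≤ m → guess (pre p m) = g := by
  classical
  set g := Nat.find h with hg
  refine ⟨g, Nat.find_spec h, ?_⟩
  have hbad : ∀ g' < g, ∃ m, ¬ Consistent (pre p m) g' := fun g' hg' =>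
    not_forall.1 (Nat.find_min h hg')
  choose! f hf using hbad
  refine ⟨max (g + 1) ((Finset.range g).sup f), fun m hm => ?_⟩
  rw [guess, List.findIdx_eq (by rw [List.length_range, length_pre]; omega)]
  simp only [List.getElem_range, decide_eq_true_eq, decide_eq_false_iff_not]
  refine ⟨Nat.find_spec h m, fun g' hg' hc => hf g' hg' ?_⟩
  have : f g' ≤ m := (Finset.le_sup (Finset.mem_range.2 hg')).trans ((le_max_right _ _).trans hm)
  exact consistent_pre_iff.2 fun n hn => consistent_pre_iff.1 hc n (hn.trans this)

theorem exists_section_pos {B : Set (ℕ × (ℕ → Bool))} (hB : 0 < natCantorMeasure B) :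
    ∃ k, 0 < cantorMeasure {x | (k, x) ∈ B} := by
  by_contra! h
  refine hB.ne' (measure_mono_null (t := ⋃ k, {k} ×ˢ {x | (k, x) ∈ B}) ?_ ?_)
  · rintro ⟨k, x⟩ hx
    exact Set.mem_iUnion.2 ⟨k, rfl, hx⟩
  · refine measure_iUnion_null fun k => ?_
    rw [natCantorMeasure_singleton_prod]
    exact nonpos_iff_eq_zero.1 (h k)

theorem exists_consistent {p : ℕ → ℕ} {B : Set (ℕ × (ℕ → Bool))}
    (hp : Representation.FunNames Representation.natCantor Representation.sierpinski p
      (Representation.coChar B)) {k : ℕ} (hk : 0 < cantorMeasure {x | (k, x) ∈ B}) :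
    ∃ g, ∀ m, Consistent (pre p m) g := by
  obtain ⟨j, hj⟩ := ENNReal.exists_inv_two_pow_lt hk.ne'
  refine ⟨Nat.pair k j, fun m => consistent_pre_iff.2 fun n _ => ?_⟩
  simp only [Nat.unpair_pair]
  have hsub : {x | (k, x) ∈ B} ⊆ {x | binVal x n ∈ (alive (pre p n) n k).toFinset} := by
    intro x hx
    simp only [Set.mem_ofPred_eq, List.mem_toFinset, mem_alive, take_pre_of_le p le_rfl]
    refine ⟨binVal_lt x n, fun hr => ?_⟩
    rw [← pre_bits_eq_binWord, ← pre_consSeq] at hr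
    exact Representation.not_mem_of_rejects hp
      (show Representation.natCantor.Names (Representation.natBits (k, x)) (k, x) from rfl) hr hx
  have h1 := hj.le.trans (measure_mono hsub)
  rw [cantorMeasure_binVal_mem (fun t ht => (mem_alive.1 (List.mem_toFinset.1 ht)).1),
    List.toFinset_card_of_nodup (nodup_alive _ _ _)] at h1
  have h2 : (2 : ℝ≥0∞) ^ n ≤ ((alive (pre p n) n k).length : ℝ≥0∞) * 2 ^ j := by
    have h3 := mul_le_mul_left (mul_le_mul_left h1 (2 ^ j)) (2 ^ n)
    have e1 : (2⁻¹ : ℝ≥0∞) ^ j * 2 ^ j = 1 := by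
      rw [← mul_pow, ENNReal.inv_mul_cancel (by simp) (by simp), one_pow]
    have e2 : (2⁻¹ : ℝ≥0∞) ^ n * 2 ^ n = 1 := by
      rw [← mul_pow, ENNReal.inv_mul_cancel (by simp) (by simp), one_pow]
    calc (2 : ℝ≥0∞) ^ n = 2⁻¹ ^ j * 2 ^ j * 2 ^ n := by rw [e1, one_mul]
      _ ≤ _ := h3
      _ = (alive (pre p n) n k).length * 2 ^ j * (2⁻¹ ^ n * 2 ^ n) := by ring
      _ = _ := by rw [e2, mul_one]
  exact_mod_cast h2

/-- The binary words compatible with a path `0^k 1 x` such that the prefix `v` does not reject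
`(k, x)`. -/
def InTree (v : List ℕ) (k : ℕ) (w : List Bool) : Prop :=
  (¬ ∃ m, m < w.length ∧ m ≤ k ∧ w[m]? ≠ some (decide (m = k))) ∧
    ¬ Representation.Rejects (v.take w.length) (k :: (w.drop (k + 1)).map Bool.toNat)

@[fun_prop] theorem primrecPred_inTree :
    PrimrecPred fun z : List ℕ × ℕ × List Bool => InTree z.1 z.2.1 z.2.2 := by
  unfold InTree; fun_prop

/-- The tree of the paths `0^k 1 x` with `(k, x)` not rejected by `p`. -/
def sectionTree (p : ℕ → ℕ) (k : ℕ) : BinTree :=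
  ⟨{w | InTree (pre p w.length) k w}, by
    rintro u w huw ⟨h1, h2⟩
    have hl := huw.length_le
    refine ⟨fun ⟨m, hm, hmk, hne⟩ => h1 ⟨m, by omega, hmk, ?_⟩, fun hr => h2 ?_⟩
    · rwa [getElem?_of_prefix huw hm]
    · rw [take_pre_of_le p le_rfl] at hr ⊢
      refine hr.mono (pre_prefix p hl) ?_
      obtain ⟨t, rfl⟩ := huw
      rw [List.drop_append, List.map_append, ← List.cons_append]
      exact List.prefix_append _ _⟩

theorem mem_paths_sectionTree {p : ℕ → ℕ} {B : Set (ℕ × (ℕ → Bool))}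
    (hp : Representation.FunNames Representation.natCantor Representation.sierpinski p
      (Representation.coChar B)) {k : ℕ} {x : ℕ → Bool} :
    x ∈ (sectionTree p k).paths ↔
      (∀ m ≤ k, x m = decide (m = k)) ∧ (k, fun i => x (k + 1 + i)) ∈ B := by
  have hdrop : ∀ n, k :: (((List.range n).map x).drop (k + 1)).map Bool.toNat =
      pre (Representation.natBits (k, fun i => x (k + 1 + i))) (n - (k + 1) + 1) := by
    intro n
    rw [Representation.natBits, pre_consSeq]
    congr 1
    apply List.ext_getElem
    · simp
    · intro i h1 h2
      simp [pre, Representation.bits]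
  have hname : Representation.natCantor.Names
    (Representation.natBits (k, fun i => x (k + 1 + i))) (k, fun i => x (k + 1 + i)) := rfl
  constructor
  · intro hx
    refine ⟨fun m hm => ?_, ?_⟩
    · by_contra hne
      refine (hx (m + 1)).1 ⟨m, by simp, hm, ?_⟩
      simpa using hne
    · by_contra hB
      obtain ⟨T, hT⟩ := Representation.rejects_of_not_mem hp hname hB
      refine (hx (T + k + 1)).2 ?_
      rw [hdrop, take_pre_of_le p le_rfl]
      exact hT _ _ (by simp; omega) (by omega)
  · rintro ⟨h1, h2⟩ n
    refine ⟨?_, fun hr => ?_⟩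
    · rintro ⟨m, hm, hmk, hne⟩
      simp only [List.length_map, List.length_range] at hm
      refine hne ?_
      simp [hm, h1 m hmk]
    · rw [hdrop, take_pre_of_le p le_rfl] at hr
      exact Representation.not_mem_of_rejects hp hname hr h2

theorem binVal_eq_one_iff {x : ℕ → Bool} {k : ℕ} :
    binVal x (k + 1) = 1 ↔ ∀ m ≤ k, x m = decide (m = k) := by
  rw [binVal_eq_iff (Nat.one_lt_two_pow (by omega))]
  have h : ∀ m ≤ k, Nat.testBit 1 (k + 1 - 1 - m) = decide (m = k) := by
    intro m hm
    rw [← pow_zero 2, Nat.testBit_two_pow]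
    congr 1
    simp only [eq_iff_iff]
    omega
  exact ⟨fun hx m hm => by rw [hx m (by omega), h m hm],
    fun hx m hm => by rw [hx m (by omega), h m (by omega)]⟩

theorem cantorMeasure_paths_sectionTree_pos {p : ℕ → ℕ} {B : Set (ℕ × (ℕ → Bool))}
    (hp : Representation.FunNames Representation.natCantor Representation.sierpinski p
      (Representation.coChar B)) {g : ℕ} (hg : ∀ m, Consistent (pre p m) g) :
    0 < cantorMeasure (sectionTree p g.unpair.1).paths := by
  set k := g.unpair.1 with hk
  set j := g.unpair.2 with hj
  set S : ℕ → Finset ℕ := fun n =>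
    (alive (pre p n) n k).toFinset.map (addLeftEmbedding (2 ^ n)) with hS
  set U : ℕ → Set (ℕ → Bool) := fun n => {x | binVal x (k + 1 + n) ∈ S n} with hU
  have hmem : ∀ n x, x ∈ U n ↔ (∀ m ≤ k, x m = decide (m = k)) ∧
      ¬ Representation.Rejects (pre p n)
        (k :: pre (Representation.bits fun i => x (k + 1 + i)) n) := by
    intro n x
    have hb := binVal_lt (fun i => x (k + 1 + i)) n
    simp only [hU, hS, Set.mem_ofPred_eq, Finset.mem_map, List.mem_toFinset, mem_alive,
      take_pre_of_le p le_rfl, addLeftEmbedding_apply, binVal_add x (k + 1) n, ← binVal_eq_one_iff,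
      pre_bits_eq_binWord]
    constructor
    · rintro ⟨t, ⟨ht, hr⟩, he⟩
      have h1 : binVal x (k + 1) = 1 := by
        have := congrArg (· / 2 ^ n) he
        rw [Nat.add_div_left _ (by positivity), Nat.div_eq_of_lt ht, mul_comm,
          Nat.mul_add_div (by positivity), Nat.div_eq_of_lt hb] at this
        omega
      rw [h1, one_mul] at he
      obtain rfl : t = _ := by simpa using he
      exact ⟨h1, hr⟩
    · rintro ⟨h1, hr⟩
      exact ⟨_, ⟨hb, hr⟩, by rw [h1, one_mul]⟩
  have hsub : ⋂ n, U n ⊆ (sectionTree p k).paths := by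
    intro x hx
    have hx' := fun n => (hmem n x).1 (Set.mem_iInter.1 hx n)
    refine (mem_paths_sectionTree hp).2 ⟨(hx' 0).1, ?_⟩
    by_contra hB
    obtain ⟨T, hT⟩ := Representation.rejects_of_not_mem hp
      (show Representation.natCantor.Names
        (Representation.natBits (k, fun i => x (k + 1 + i))) _ from rfl) hB
    refine (hx' T).2 ?_
    have := hT T (T + 1) le_rfl (by omega)
    rwa [Representation.natBits, pre_consSeq] at this
  have hanti : Antitone U := by
    intro m n hmn x hx
    rw [hmem] at hx ⊢
    refine ⟨hx.1, fun hr => hx.2 (hr.mono (pre_prefix p hmn) ?_)⟩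
    exact List.cons_prefix_cons.2 ⟨rfl, pre_prefix _ hmn⟩
  have hmeas : ∀ n, MeasurableSet (U n) := fun n => measurableSet_binVal_mem _ _
  have hlow : ∀ n, (2⁻¹ : ℝ≥0∞) ^ (k + 1 + j) ≤ cantorMeasure (U n) := by
    intro n
    have hcard : (S n).card = (alive (pre p n) n k).length := by
      rw [hS, Finset.card_map, List.toFinset_card_of_nodup (nodup_alive _ _ _)]
    have hlt : ∀ t ∈ S n, t < 2 ^ (k + 1 + n) := by
      intro t ht
      simp only [hS, Finset.mem_map, List.mem_toFinset, mem_alive, addLeftEmbedding_apply] at ht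
      obtain ⟨s, ⟨hs, -⟩, rfl⟩ := ht
      have h1 : 2 ^ (k + 1 + n) = 2 ^ k * (2 * 2 ^ n) := by ring
      have h2 : 1 * (2 * 2 ^ n) ≤ 2 ^ k * (2 * 2 ^ n) :=
        Nat.mul_le_mul_right _ Nat.one_le_two_pow
      omega
    have hc : (2 : ℝ≥0∞) ^ n ≤ (alive (pre p n) n k).length * 2 ^ j := by
      exact_mod_cast consistent_pre_iff.1 (hg n) n le_rfl
    rw [hU, cantorMeasure_binVal_mem hlt, hcard]
    have e : ∀ i : ℕ, (2 : ℝ≥0∞) ^ i * 2⁻¹ ^ i = 1 := fun i => by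
      rw [← mul_pow, ENNReal.mul_inv_cancel (by simp) (by simp), one_pow]
    calc (2⁻¹ : ℝ≥0∞) ^ (k + 1 + j) = 2⁻¹ ^ (k + 1) * 2⁻¹ ^ j * (2 ^ n * 2⁻¹ ^ n) := by
          rw [e, mul_one, pow_add]
      _ = 2 ^ n * (2⁻¹ ^ (k + 1) * 2⁻¹ ^ n * 2⁻¹ ^ j) := by ring
      _ ≤ (alive (pre p n) n k).length * 2 ^ j * (2⁻¹ ^ (k + 1) * 2⁻¹ ^ n * 2⁻¹ ^ j) :=
          mul_le_mul_left hc _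
      _ = (alive (pre p n) n k).length * 2⁻¹ ^ (k + 1 + n) * (2 ^ j * 2⁻¹ ^ j) := by
          rw [pow_add 2⁻¹ (k + 1) n]; ring
      _ = _ := by rw [e, mul_one]
  have hlim := tendsto_measure_iInter_atTop (μ := cantorMeasure)
    (fun n => (hmeas n).nullMeasurableSet) hanti ⟨0, measure_ne_top _ _⟩
  have : (2⁻¹ : ℝ≥0∞) ^ (k + 1 + j) ≤ cantorMeasure (⋂ n, U n) :=
    ge_of_tendsto' hlim hlow
  refine lt_of_lt_of_le ?_ (this.trans (measure_mono hsub))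
  exact ENNReal.pow_pos (by simp) _

/-- The partial function `0^k 1 s ↦ k s`. -/
noncomputable def unpad : (ℕ → ℕ) →. (ℕ → ℕ) := fun s =>
  open Classical in
  ⟨∃ k, s k = 1, fun h => consSeq (Nat.find h) fun n => s (Nat.find h + 1 + n)⟩

theorem computableFun_unpad : ComputableFun unpad := by
  classical
  refine computableFun_of_step (g := fun v n =>
    if n = 0 then (if v.findIdx (fun a => decide (a = 1)) < v.length then
      some (v.findIdx fun a => decide (a = 1)) else none)
    else v[(v.findIdx fun a => decide (a = 1)) + n]?) (Primrec.to_comp (by fun_prop)) ?_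
  rintro s q ⟨hs, rfl⟩
  have hfind : ∀ m, Nat.find hs < m →
      (pre s m).findIdx (fun a => decide (a = 1)) = Nat.find hs := by
    intro m hm
    rw [List.findIdx_eq (by simpa using hm)]
    simp only [pre, List.getElem_map, List.getElem_range, decide_eq_true_eq,
      decide_eq_false_iff_not]
    exact ⟨Nat.find_spec hs, fun j hj => Nat.find_min hs hj⟩
  have hge : ∀ m, ¬ Nat.find hs < m → (pre s m).findIdx (fun a => decide (a = 1)) = m := by
    intro m hm
    have : (pre s m).findIdx (fun a => decide (a = 1)) = (pre s m).length := by
      rw [List.findIdx_eq_length]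
      intro a ha
      simp only [pre, List.mem_map, List.mem_range] at ha
      obtain ⟨i, hi, rfl⟩ := ha
      simpa using Nat.find_min hs (show i < Nat.find hs by omega)
    rwa [length_pre] at this
  refine ⟨fun m n a h => ?_, fun n => ⟨Nat.find hs + n + 1, fun m hm => ?_⟩⟩
  · by_cases hm : Nat.find hs < m
    · rw [hfind m hm] at h
      rcases n with _ | n
      · simp only [length_pre, hm, if_true, Option.some.injEq] at h
        exact h.symm
      · simp only [Nat.add_eq_zero_iff, one_ne_zero, and_false, if_false] at h
        rw [← (getElem?_pre_eq_some.1 h).2]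
        show _ = s (Nat.find hs + 1 + n)
        congr 1
        omega
    · rw [hge m hm] at h
      rcases n with _ | n
      · simp at h
      · simp only [Nat.add_eq_zero_iff, one_ne_zero, and_false, if_false] at h
        have := (getElem?_pre_eq_some.1 h).1
        omega
  · rw [hfind m (by omega)]
    rcases n with _ | n
    · simp only [length_pre, if_true]
      rw [if_pos (by omega)]
      simp
    · simp only [Nat.add_eq_zero_iff, one_ne_zero, and_false, if_false]
      rw [getElem?_pre s (by omega)]
      simp

/-- A binary word from its code. -/
def wordOf (c : ℕ) : List Bool := (Encodable.decode c : Option (List Bool)).getD []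

@[fun_prop] theorem primrec_wordOf : Primrec wordOf := by unfold wordOf; fun_prop

@[simp] theorem wordOf_encode (w : List Bool) : wordOf (Encodable.encode w) = w := by
  rw [wordOf, Encodable.encodek, Option.getD_some]

theorem pcNatCantor_le : LeSW PCNatCantor WWKL.discreteJump := by
  classical
  refine leSW_of_total (K := fun p c =>
    if InTree (pre p (wordOf c.unpair.2).length) (guess (pre p c.unpair.1)).unpair.1
      (wordOf c.unpair.2) then 1 else 0) (H := unpad) ?_ computableFun_unpad ?_
  · refine computableFun_of_bounded
      (b := fun c => max c.unpair.1 (wordOf c.unpair.2).length)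
      (G := fun v c => if InTree (v.take (wordOf c.unpair.2).length)
        (guess (v.take c.unpair.1)).unpair.1 (wordOf c.unpair.2) then 1 else 0)
      (Primrec.to_comp (by fun_prop)) (by fun_prop) ?_
    intro p c
    rw [take_pre_of_le p (le_max_left _ _), take_pre_of_le p (le_max_right _ _)]
  · intro p B hp hB
    have hp' : Representation.FunNames Representation.natCantor Representation.sierpinski p
      (Representation.coChar B.1) := hp
    obtain ⟨k, hk⟩ := exists_section_pos (mem_dom_posChoice.1 hB)
    obtain ⟨g, hg, N, hN⟩ := guess_converges (exists_consistent hp' hk)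
    have hpos := cantorMeasure_paths_sectionTree_pos hp' hg
    refine ⟨sectionTree p g.unpair.1,
      ⟨fun c => if InTree (pre p (wordOf c).length) g.unpair.1 (wordOf c) then 1 else 0,
        ⟨N, fun i hi j => ?_⟩, fun w => ?_⟩, ?_, ?_⟩
    · simp only [Nat.unpair_pair, hN i hi]
    · simp only [wordOf_encode]
      exact ⟨fun h => if_pos h, fun h => if_neg h⟩
    · obtain ⟨x, hx⟩ := nonempty_of_measure_ne_zero hpos.ne'
      exact ⟨x, hx, hpos⟩
    · rintro q x ⟨hx, -⟩ rfl
      obtain ⟨h1, h2⟩ := (mem_paths_sectionTree hp').1 hx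
      have hex : ∃ k, Representation.bits x k = 1 :=
        ⟨g.unpair.1, by simp [Representation.bits, h1 _ le_rfl]⟩
      have hfind : Nat.find hex = g.unpair.1 := by
        rw [Nat.find_eq_iff]
        refine ⟨by simp [Representation.bits, h1 _ le_rfl], fun m hm => ?_⟩
        simp [Representation.bits, h1 m hm.le, hm.ne]
      refine ⟨_, ⟨hex, rfl⟩, (g.unpair.1, fun i => x (g.unpair.1 + 1 + i)),
        ⟨h2, mem_dom_posChoice.1 hB, le_top⟩, ?_⟩
      show consSeq (Nat.find hex) _ = _
      rw [hfind]
      rfl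

/-! ### Binary expansions and Lebesgue measure -/

/-- The real number with binary expansion `0.x₀x₁…`. -/
noncomputable def binReal (x : ℕ → Bool) : ℝ :=
  Real.ofDigits fun i => if x i then (1 : Fin 2) else 0

theorem binReal_nonneg (x : ℕ → Bool) : 0 ≤ binReal x := Real.ofDigits_nonneg _

theorem binReal_le_one (x : ℕ → Bool) : binReal x ≤ 1 := Real.ofDigits_le_one _

theorem two_pow_mul_binReal (x : ℕ → Bool) (n : ℕ) :
    2 ^ n * binReal x = binVal x n + binReal fun i => x (i + n) := by
  have hsum : (2 : ℝ) ^ n * ∑ i ∈ Finset.range n,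
      Real.ofDigitsTerm (fun i => if x i then (1 : Fin 2) else 0) i = binVal x n := by
    induction n with
    | zero => simp [binVal]
    | succ n ih =>
      rw [Finset.sum_range_succ, mul_add, pow_succ', mul_assoc, ih, binVal]
      have : (2 : ℝ) ^ n ≠ 0 := by positivity
      rcases hx : x n <;> simp [Real.ofDigitsTerm, hx, pow_succ']; field_simp
  rw [binReal, Real.ofDigits_eq_sum_add_ofDigits _ n, mul_add, hsum, ← mul_assoc]
  simp [binReal]

theorem binVal_le_mul_binReal (x : ℕ → Bool) (n : ℕ) : (binVal x n : ℝ) ≤ 2 ^ n * binReal x := by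
  rw [two_pow_mul_binReal]
  linarith [binReal_nonneg fun i => x (i + n)]

theorem mul_binReal_le_binVal_add_one (x : ℕ → Bool) (n : ℕ) :
    2 ^ n * binReal x ≤ binVal x n + 1 := by
  rw [two_pow_mul_binReal]
  linarith [binReal_le_one fun i => x (i + n)]

theorem measurable_binReal : Measurable binReal := by
  refine (Real.continuous_ofDigits.comp (continuous_pi fun i => ?_)).measurable
  exact (continuous_of_discreteTopology (f := fun b : Bool => if b then (1 : Fin 2) else 0)).comp
    (continuous_apply i)

theorem cantorMeasure_binReal_le {a : ℝ} (h0 : 0 ≤ a) (h1 : a < 1) :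
    cantorMeasure {x | binReal x ≤ a} = ENNReal.ofReal a := by
  rw [← ENNReal.ofReal_toReal (measure_ne_top cantorMeasure {x | binReal x ≤ a})]
  congr 1
  have hreal : ∀ n k : ℕ, k ≤ 2 ^ n →
      (cantorMeasure {x | binVal x n ∈ Finset.range k}).toReal = k * 2⁻¹ ^ n := by
    intro n k hk
    rw [cantorMeasure_binVal_mem fun t ht => (Finset.mem_range.1 ht).trans_le hk]
    simp
  have key : ∀ n : ℕ, |(cantorMeasure {x | binReal x ≤ a}).toReal - a| ≤ (2⁻¹ : ℝ) ^ n := by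
    intro n
    have hpow : (0 : ℝ) < 2 ^ n := by positivity
    set k := ⌊2 ^ n * a⌋₊ with hk
    have hk1 : (k : ℝ) ≤ 2 ^ n * a := Nat.floor_le (by positivity)
    have hk2 : 2 ^ n * a < k + 1 := Nat.lt_floor_add_one _
    have hk3 : k < 2 ^ n := by
      have : (k : ℝ) < 2 ^ n := by nlinarith
      exact_mod_cast this
    have l1 : (k : ℝ) * 2⁻¹ ^ n ≤ (cantorMeasure {x | binReal x ≤ a}).toReal := by
      rw [← hreal n k hk3.le]
      refine ENNReal.toReal_mono (measure_ne_top _ _) (measure_mono fun x hx => ?_)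
      have h2 : ((binVal x n : ℝ) + 1) ≤ k := by exact_mod_cast Finset.mem_range.1 hx
      have h3 := mul_binReal_le_binVal_add_one x n
      exact le_of_mul_le_mul_left (h3.trans (h2.trans hk1)) hpow
    have l2 : (cantorMeasure {x | binReal x ≤ a}).toReal ≤ ((k : ℝ) + 1) * 2⁻¹ ^ n := by
      have := hreal n (k + 1) hk3
      push_cast at this
      rw [← this]
      refine ENNReal.toReal_mono (measure_ne_top _ _) (measure_mono fun x hx => ?_)
      have hx' : binReal x ≤ a := hx
      have h2 := binVal_le_mul_binReal x n
      have h3 : (binVal x n : ℝ) < k + 1 := by nlinarith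
      exact Finset.mem_range.2 (by exact_mod_cast h3)
    have e : a = 2 ^ n * a * 2⁻¹ ^ n := by
      rw [inv_pow]; field_simp
    have hinv : (0 : ℝ) < 2⁻¹ ^ n := by positivity
    rw [abs_le]
    constructor <;> nlinarith
  by_contra hne
  obtain ⟨n, hn⟩ := exists_pow_lt_of_lt_one (abs_pos.2 (sub_ne_zero.2 hne))
    (by norm_num : (2⁻¹ : ℝ) < 1)
  exact absurd (key n) (not_le.2 hn)

theorem map_binReal : cantorMeasure.map binReal = volume.restrict (Set.Icc 0 1) := by
  have : IsProbabilityMeasure (cantorMeasure.map binReal) :=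
    Measure.isProbabilityMeasure_map measurable_binReal.aemeasurable
  refine Measure.ext_of_Iic _ _ fun a => ?_
  rw [Measure.map_apply measurable_binReal measurableSet_Iic,
    Measure.restrict_apply measurableSet_Iic]
  show cantorMeasure {x | binReal x ≤ a} = _
  rcases lt_or_ge a 0 with ha | ha
  · have e1 : {x | binReal x ≤ a} = ∅ := by
      ext x
      have := binReal_nonneg x
      simp only [Set.mem_ofPred_eq, Set.mem_empty_iff_false, iff_false]
      linarith
    have e2 : Set.Iic a ∩ Set.Icc 0 1 = ∅ := by
      ext x
      simp only [Set.mem_inter_iff, Set.mem_Iic, Set.mem_Icc, Set.mem_empty_iff_false, iff_false]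
      intro h
      linarith [h.1, h.2.1]
    rw [e1, e2]
    simp
  · rcases lt_or_ge a 1 with ha1 | ha1
    · have e2 : Set.Iic a ∩ Set.Icc 0 1 = Set.Icc 0 a := by
        ext x
        simp only [Set.mem_inter_iff, Set.mem_Iic, Set.mem_Icc]
        constructor
        · exact fun h => ⟨h.2.1, h.1⟩
        · exact fun h => ⟨h.2, h.1, h.2.trans ha1.le⟩
      rw [cantorMeasure_binReal_le ha ha1, e2, Real.volume_Icc, sub_zero]
    · have e1 : {x | binReal x ≤ a} = Set.univ := by
        ext x
        simp [(binReal_le_one x).trans ha1]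
      have e2 : Set.Iic a ∩ Set.Icc 0 1 = Set.Icc 0 1 :=
        Set.inter_eq_right.2 fun x hx => hx.2.trans ha1
      rw [e1, e2, measure_univ, Real.volume_Icc]
      simp

theorem cantorMeasure_add_binReal {A : Set ℝ} (hA : MeasurableSet A) (z : ℝ) :
    cantorMeasure {x | z + binReal x ∈ A} = volume (A ∩ Set.Icc z (z + 1)) := by
  have hm : MeasurableSet ((fun t => z + t) ⁻¹' A) := measurable_const_add z hA
  have h1 : cantorMeasure {x | z + binReal x ∈ A} =
      cantorMeasure.map binReal ((fun t => z + t) ⁻¹' A) := by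
    rw [Measure.map_apply measurable_binReal hm]
    rfl
  rw [h1, map_binReal, Measure.restrict_apply hm,
    ← measure_preimage_add volume z (A ∩ Set.Icc z (z + 1))]
  congr 1
  ext t
  simp

/-! ### Closed sets of real numbers -/

theorem isClosed_of_real_funNames {p : ℕ → ℕ} {A : Set ℝ}
    (hp : Representation.FunNames Representation.real Representation.sierpinski p
      (Representation.coChar A)) : IsClosed A := by
  rw [← isOpen_compl_iff, Metric.isOpen_iff]
  intro y hy
  obtain ⟨s, hs⟩ := Representation.real.surj y
  have hs1 : ∀ n, |(Representation.ratOf (s (n + 1)) : ℝ) - y| ≤ (1 / 2) ^ (n + 1) :=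
    fun n => hs (n + 1)
  have hname : Representation.real.Names (fun n => s (n + 1)) y := fun n =>
    (hs1 n).trans (pow_le_pow_of_le_one (by norm_num) (by norm_num) (Nat.le_succ n))
  obtain ⟨T, hT⟩ := Representation.rejects_of_not_mem hp hname hy
  refine ⟨(1 / 2) ^ T, by positivity, fun y' hy' => ?_⟩
  rw [Metric.mem_ball, Real.dist_eq] at hy'
  obtain ⟨s', hs'⟩ := Representation.real.surj y'
  have hname' : Representation.real.Names (fun n => if n < T then s (n + 1) else s' n) y' := by
    intro n
    by_cases hn : n < T
    · simp only [hn, if_true]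
      have h1 := hs1 n
      have h2 : ((1 : ℝ) / 2) ^ T ≤ (1 / 2) ^ (n + 1) :=
        pow_le_pow_of_le_one (by norm_num) (by norm_num) hn
      have h3 : ((1 : ℝ) / 2) ^ n = (1 / 2) ^ (n + 1) + (1 / 2) ^ (n + 1) := by ring
      rw [abs_le] at h1 ⊢
      rw [abs_lt] at hy'
      constructor <;> linarith [h1.1, h1.2, hy'.1, hy'.2]
    · simp only [hn, if_false]
      exact hs' n
  have hr := hT T T le_rfl le_rfl
  rw [pre_congr (p := fun n => s (n + 1)) (q := fun n => if n < T then s (n + 1) else s' n)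
    (fun i hi => by simp [hi])] at hr
  exact Representation.not_mem_of_rejects hp hname' hr

/-! ### From real numbers to `ℕ × 2^ℕ` -/

/-- The number with the given binary digits, most significant digit first. -/
def horner (w : List ℕ) : ℕ := w.foldl (fun a b => 2 * a + b) 0

@[fun_prop] theorem primrec_horner : Primrec horner := by unfold horner; fun_prop

theorem horner_pre_bits (x : ℕ → Bool) (n : ℕ) :
    horner (pre (Representation.bits x) n) = binVal x n := by
  induction n with
  | zero => rfl
  | succ n ih => rw [pre_succ, horner, List.foldl_append, ← horner, ih]; rfl

/-- The code of the rational number `z + t / 2^n`, where `z` is the `k`-th integer. -/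
def dyadicCode (k n t : ℕ) : ℕ :=
  Nat.pair (Nat.pair (k.unpair.1 * 2 ^ n + t) (k.unpair.2 * 2 ^ n)) (2 ^ n - 1)

@[fun_prop] theorem primrec_dyadicCode :
    Primrec fun z : ℕ × ℕ × ℕ => dyadicCode z.1 z.2.1 z.2.2 := by
  unfold dyadicCode; fun_prop

/-- The integer with code `k`. -/
def intOf (k : ℕ) : ℤ := (k.unpair.1 : ℤ) - k.unpair.2

theorem intOf_surjective : Function.Surjective intOf := by
  intro z
  refine ⟨Nat.pair z.toNat (-z).toNat, ?_⟩
  simp only [intOf, Nat.unpair_pair]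
  omega

theorem ratOf_dyadicCode (k n t : ℕ) :
    (Representation.ratOf (dyadicCode k n t) : ℝ) = intOf k + t / 2 ^ n := by
  have h : (((2 ^ n - 1 : ℕ) : ℝ) + 1) = 2 ^ n := by
    rw [Nat.cast_sub Nat.one_le_two_pow]
    push_cast
    ring
  simp only [Representation.ratOf, dyadicCode, Nat.unpair_pair, intOf]
  push_cast
  rw [h]
  field_simp
  ring

/-- The Cauchy name of `z + 0.x₀x₁…`, where `z` is the `k`-th integer. -/
def cauchySeq (a : ℕ × (ℕ → Bool)) : ℕ → ℕ := fun n => dyadicCode a.1 n (binVal a.2 n)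

theorem real_names_cauchySeq (a : ℕ × (ℕ → Bool)) :
    Representation.real.Names (cauchySeq a) (intOf a.1 + binReal a.2) := by
  intro n
  rw [cauchySeq, ratOf_dyadicCode]
  have h1 := binVal_le_mul_binReal a.2 n
  have h2 := mul_binReal_le_binVal_add_one a.2 n
  have hpow : (0 : ℝ) < 2 ^ n := by positivity
  have e : (intOf a.1 : ℝ) + binVal a.2 n / 2 ^ n - (intOf a.1 + binReal a.2) =
      (binVal a.2 n - 2 ^ n * binReal a.2) / 2 ^ n := by field_simp; ring
  rw [e, abs_div, abs_of_pos hpow, div_pow, one_pow]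
  gcongr
  rw [abs_le]
  constructor <;> linarith

/-- The prefix of the Cauchy name determined by a prefix of `k x`. -/
def cauchyWord (u : List ℕ) : List ℕ :=
  (List.range u.length).map fun n => dyadicCode (u[0]?.getD 0) n (horner (u.tail.take n))

@[fun_prop] theorem primrec_cauchyWord : Primrec cauchyWord := by unfold cauchyWord; fun_prop

theorem cauchyWord_pre (a : ℕ × (ℕ → Bool)) (m : ℕ) :
    cauchyWord (pre (Representation.natBits a) m) = pre (cauchySeq a) m := by
  rcases m with _ | m
  · rfl
  simp only [cauchyWord, length_pre]
  refine List.map_congr_left fun n hn => ?_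
  have := List.mem_range.1 hn
  rw [Representation.natBits, pre_consSeq, List.tail_cons, take_pre_of_le _ (by omega),
    horner_pre_bits]
  rfl

theorem cauchyWord_getElem (a : ℕ × (ℕ → Bool)) :
    (fun n => (cauchyWord (pre (Representation.natBits a) (n + 1)))[n]?.getD 0) = cauchySeq a := by
  funext n
  rw [cauchyWord_pre, getElem?_pre _ (Nat.lt_succ_self n)]
  rfl

theorem computableFun_cauchy : ComputableFun fun s => Part.some fun n =>
    (cauchyWord (pre s (n + 1)))[n]?.getD 0 :=
  computableFun_of_bounded (b := fun n => n + 1) (G := fun v n => (cauchyWord v)[n]?.getD 0)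
    (Primrec.to_comp (by fun_prop)) (by fun_prop) fun _ _ => rfl

theorem pcReal_le : LeSW PCReal PCNatCantor := by
  classical
  refine leSW_of_total (computableFun_associate
    (E := fun v u => decide (Representation.Rejects v (cauchyWord u))) ?_)
    computableFun_cauchy ?_
  · exact (show Primrec fun z : List ℕ × List ℕ =>
      decide (Representation.Rejects z.1 (cauchyWord z.2)) by fun_prop).to_comp
  intro p A hp hA
  have hp' : Representation.FunNames Representation.real Representation.sierpinski p
    (Representation.coChar A.1) := hp
  set B : Set (ℕ × (ℕ → Bool)) := {a | (intOf a.1 : ℝ) + binReal a.2 ∈ A.1} with hB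
  have hname : Representation.FunNames Representation.natCantor Representation.sierpinski
      (associate (fun v u => decide (Representation.Rejects v (cauchyWord u))) p)
      (Representation.coChar B) := by
    refine Representation.funNames_associate ?_
    rintro s a rfl
    simp only [decide_eq_true_eq, cauchyWord_pre]
    constructor
    · intro ha
      obtain ⟨T, hT⟩ := Representation.rejects_of_not_mem hp' (real_names_cauchySeq a) ha
      exact ⟨T, hT T T le_rfl le_rfl⟩
    · rintro ⟨n, hn⟩ ha
      exact Representation.not_mem_of_rejects hp' (real_names_cauchySeq a) hn ha
  have hApos : 0 < volume A.1 := mem_dom_posChoice.1 hA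
  have hpos : 0 < natCantorMeasure B := by
    by_contra! h0
    have hB0 : natCantorMeasure B = 0 := nonpos_iff_eq_zero.1 h0
    refine hApos.ne' (measure_mono_null
      (t := ⋃ k : ℕ, A.1 ∩ Set.Icc (intOf k : ℝ) (intOf k + 1)) ?_ ?_)
    · intro y hy
      obtain ⟨k, hk⟩ := intOf_surjective ⌊y⌋
      refine Set.mem_iUnion.2 ⟨k, hy, ?_⟩
      rw [hk]
      exact ⟨Int.floor_le y, (Int.lt_floor_add_one y).le⟩
    · refine measure_iUnion_null fun k => ?_
      rw [← cantorMeasure_add_binReal (isClosed_of_real_funNames hp').measurableSet,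
        ← natCantorMeasure_singleton_prod k]
      refine measure_mono_null ?_ hB0
      rintro ⟨k', x⟩ ⟨hk', hx⟩
      obtain rfl : k' = k := hk'
      exact hx
  refine ⟨⟨B, Representation.isClosed_of_funNames hname⟩, hname, mem_dom_posChoice.2 hpos, ?_⟩
  rintro s a ⟨ha, -⟩ rfl
  refine ⟨_, Part.mem_some _, (intOf a.1 : ℝ) + binReal a.2, ⟨ha, hApos, le_top⟩, ?_⟩
  exact (cauchyWord_getElem a).symm ▸ real_names_cauchySeq a

open Filter

/-! ### Rational intervals around a real number -/

/-- The common denominator of the bounds given by the `m`-th entry `c` of a Cauchy name. -/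
def den (c m : ℕ) : ℕ := (c.unpair.2 + 1) * 2 ^ m

/-- The numerator of the lower bound, truncated at zero. -/
def lo (c m : ℕ) : ℕ :=
  c.unpair.1.unpair.1 * 2 ^ m - (c.unpair.1.unpair.2 * 2 ^ m + (c.unpair.2 + 1))

/-- The numerator of the upper bound, truncated at zero. -/
def hi (c m : ℕ) : ℕ :=
  c.unpair.1.unpair.1 * 2 ^ m + (c.unpair.2 + 1) - c.unpair.1.unpair.2 * 2 ^ m

@[fun_prop] theorem primrec_den : Primrec fun z : ℕ × ℕ => den z.1 z.2 := by
  unfold den; fun_prop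

@[fun_prop] theorem primrec_lo : Primrec fun z : ℕ × ℕ => lo z.1 z.2 := by
  unfold lo; fun_prop

@[fun_prop] theorem primrec_hi : Primrec fun z : ℕ × ℕ => hi z.1 z.2 := by
  unfold hi; fun_prop

theorem den_pos (c m : ℕ) : 0 < den c m := by unfold den; positivity

theorem natCast_tsub (a b : ℕ) : ((a - b : ℕ) : ℝ) = max ((a : ℝ) - b) 0 := by
  rcases le_total b a with h | h
  · rw [Nat.cast_sub h, max_eq_left]
    have : (b : ℝ) ≤ a := by exact_mod_cast h
    linarith
  · rw [Nat.sub_eq_zero_of_le h, max_eq_right, Nat.cast_zero]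
    have : (a : ℝ) ≤ b := by exact_mod_cast h
    linarith

theorem max_zero_div {a d : ℝ} (hd : 0 < d) : max a 0 / d = max (a / d) 0 := by
  rw [max_div_div_right hd.le a 0 |>.symm, zero_div]

theorem lo_div_den (c m : ℕ) :
    (lo c m : ℝ) / den c m = max ((Representation.ratOf c : ℝ) - (1 / 2) ^ m) 0 := by
  have hd : (0 : ℝ) < den c m := by exact_mod_cast den_pos c m
  rw [lo, natCast_tsub, max_zero_div hd]
  congr 1
  simp only [den, Representation.ratOf]
  push_cast
  have h1 : ((c.unpair.2 : ℝ) + 1) ≠ 0 := by positivity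
  rw [div_pow, one_pow]
  field_simp
  ring

theorem hi_div_den (c m : ℕ) :
    (hi c m : ℝ) / den c m = max ((Representation.ratOf c : ℝ) + (1 / 2) ^ m) 0 := by
  have hd : (0 : ℝ) < den c m := by exact_mod_cast den_pos c m
  rw [hi, natCast_tsub, max_zero_div hd]
  congr 1
  simp only [den, Representation.ratOf]
  push_cast
  have h1 : ((c.unpair.2 : ℝ) + 1) ≠ 0 := by positivity
  rw [div_pow, one_pow]
  field_simp
  ring

theorem lo_div_den_le {c m : ℕ} {y : ℝ} (hy : 0 ≤ y)
    (h : |(Representation.ratOf c : ℝ) - y| ≤ (1 / 2) ^ m) : (lo c m : ℝ) / den c m ≤ y := by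
  rw [lo_div_den]
  exact max_le (by linarith [(abs_le.1 h).2]) hy

theorem le_hi_div_den {c m : ℕ} {y : ℝ}
    (h : |(Representation.ratOf c : ℝ) - y| ≤ (1 / 2) ^ m) : y ≤ (hi c m : ℝ) / den c m := by
  rw [hi_div_den]
  exact le_max_of_le_left (by linarith [(abs_le.1 h).1])

theorem tendsto_ratOf {s : ℕ → ℕ} {y : ℝ} (hs : Representation.real.Names s y) :
    Tendsto (fun m => (Representation.ratOf (s m) : ℝ)) atTop (𝓝 y) := by
  rw [tendsto_iff_dist_tendsto_zero]
  exact squeeze_zero (fun _ => dist_nonneg) hs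
    (tendsto_pow_atTop_nhds_zero_of_lt_one (by norm_num) (by norm_num))

theorem tendsto_lo_div_den {s : ℕ → ℕ} {y : ℝ} (hs : Representation.real.Names s y) :
    Tendsto (fun m => (lo (s m) m : ℝ) / den (s m) m) atTop (𝓝 (max y 0)) := by
  simp only [lo_div_den]
  have h : Tendsto (fun m : ℕ => ((1 : ℝ) / 2) ^ m) atTop (𝓝 0) :=
    tendsto_pow_atTop_nhds_zero_of_lt_one (by norm_num) (by norm_num)
  simpa using ((tendsto_ratOf hs).sub h).max tendsto_const_nhds

theorem tendsto_hi_div_den {s : ℕ → ℕ} {y : ℝ} (hs : Representation.real.Names s y) :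
    Tendsto (fun m => (hi (s m) m : ℝ) / den (s m) m) atTop (𝓝 (max y 0)) := by
  simp only [hi_div_den]
  have h : Tendsto (fun m : ℕ => ((1 : ℝ) / 2) ^ m) atTop (𝓝 0) :=
    tendsto_pow_atTop_nhds_zero_of_lt_one (by norm_num) (by norm_num)
  simpa using ((tendsto_ratOf hs).add h).max tendsto_const_nhds

/-! ### Digits of a real number -/

/-- A real number `y ≥ 0` as an element of `ℕ × 2^ℕ`: the first component of its integer part and
its binary digits after the point. -/
noncomputable def realCode (y : ℝ) : ℕ × (ℕ → Bool) :=
  (⌊y⌋₊.unpair.1, fun i => decide (⌊2 ^ (i + 1) * y⌋₊ % 2 = 1))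

/-- The integer part of `2 ^ n * y`, if it is determined by the bounds for `y`. -/
def floorOf (c m n : ℕ) : Option ℕ :=
  if 2 ^ n * lo c m / den c m = 2 ^ n * hi c m / den c m then some (2 ^ n * lo c m / den c m)
  else none

/-- The `n`-th entry of the name of `realCode y`, if it is determined by the bounds for `y`. -/
def codeEntry (c m n : ℕ) : Option ℕ :=
  if n = 0 then (floorOf c m n).map fun a => a.unpair.1 else (floorOf c m n).map fun a => a % 2

@[fun_prop] theorem primrec_floorOf : Primrec fun z : ℕ × ℕ × ℕ => floorOf z.1 z.2.1 z.2.2 := by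
  unfold floorOf; fun_prop

@[fun_prop] theorem primrec_codeEntry :
    Primrec fun z : ℕ × ℕ × ℕ => codeEntry z.1 z.2.1 z.2.2 := by
  unfold codeEntry; fun_prop

theorem natDiv_eq_floor (a c m n : ℕ) :
    2 ^ n * a / den c m = ⌊2 ^ n * ((a : ℝ) / den c m)⌋₊ := by
  rw [← Nat.floor_div_eq_div (K := ℝ)]
  congr 1
  push_cast
  ring

theorem floorOf_eq_some {c m n a : ℕ} {y : ℝ} (hy : 0 ≤ y)
    (h : |(Representation.ratOf c : ℝ) - y| ≤ (1 / 2) ^ m) (ha : floorOf c m n = some a) :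
    a = ⌊2 ^ n * y⌋₊ := by
  simp only [floorOf] at ha
  split_ifs at ha with he
  have h1 : ⌊2 ^ n * ((lo c m : ℝ) / den c m)⌋₊ ≤ ⌊2 ^ n * y⌋₊ :=
    Nat.floor_mono (by gcongr; exact lo_div_den_le hy h)
  have h2 : ⌊2 ^ n * y⌋₊ ≤ ⌊2 ^ n * ((hi c m : ℝ) / den c m)⌋₊ :=
    Nat.floor_mono (by gcongr; exact le_hi_div_den h)
  rw [← natDiv_eq_floor] at h1 h2
  have := Option.some.inj ha
  omega

theorem codeEntry_eq_some {c m n a : ℕ} {y : ℝ} (hy : 0 ≤ y)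
    (h : |(Representation.ratOf c : ℝ) - y| ≤ (1 / 2) ^ m) (ha : codeEntry c m n = some a) :
    a = Representation.natBits (realCode y) n := by
  rcases n with _ | n
  · simp only [codeEntry, if_true, Option.map_eq_some_iff] at ha
    obtain ⟨b, hb, rfl⟩ := ha
    rw [floorOf_eq_some hy h hb, pow_zero, one_mul]
    rfl
  · simp only [codeEntry, Nat.add_eq_zero_iff, one_ne_zero, and_false, if_false,
      Option.map_eq_some_iff] at ha
    obtain ⟨b, hb, rfl⟩ := ha
    rw [floorOf_eq_some hy h hb]
    show _ = (decide (⌊2 ^ (n + 1) * y⌋₊ % 2 = 1)).toNat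
    rcases Nat.mod_two_eq_zero_or_one ⌊2 ^ (n + 1) * y⌋₊ with h | h <;> simp [h]

theorem codeEntry_ne_none {s : ℕ → ℕ} {y : ℝ} (hs : Representation.real.Names s y) (hy : 0 ≤ y)
    (hd : ∀ n j : ℕ, 2 ^ n * y ≠ j) (n : ℕ) :
    ∃ m₀, ∀ m, m₀ ≤ m → codeEntry (s m) m n ≠ none := by
  have hfl : ∀ᶠ t in 𝓝 y, ⌊2 ^ n * t⌋₊ = ⌊2 ^ n * y⌋₊ := by
    have h1 : (⌊2 ^ n * y⌋₊ : ℝ) < 2 ^ n * y :=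
      lt_of_le_of_ne (Nat.floor_le (by positivity)) (hd n _).symm
    have h2 : 2 ^ n * y < ⌊2 ^ n * y⌋₊ + 1 := Nat.lt_floor_add_one _
    have hc : Tendsto (fun t : ℝ => 2 ^ n * t) (𝓝 y) (𝓝 (2 ^ n * y)) :=
      tendsto_const_nhds.mul tendsto_id
    filter_upwards [hc.eventually_const_lt h1, hc.eventually_lt_const h2] with t ht1 ht2
    rw [Nat.floor_eq_iff ((Nat.cast_nonneg _).trans ht1.le)]
    exact ⟨ht1.le, ht2⟩
  have hmax : max y 0 = y := max_eq_left hy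
  have h1 := (tendsto_lo_div_den hs).eventually (hmax.symm ▸ hfl)
  have h2 := (tendsto_hi_div_den hs).eventually (hmax.symm ▸ hfl)
  obtain ⟨m₀, hm₀⟩ := eventually_atTop.1 (h1.and h2)
  refine ⟨m₀, fun m hm => ?_⟩
  obtain ⟨e1, e2⟩ := hm₀ m hm
  have : floorOf (s m) m n ≠ none := by
    rw [floorOf, natDiv_eq_floor, natDiv_eq_floor, e1, e2]
    simp
  unfold codeEntry
  split_ifs <;> simpa using this

/-- The partial function that maps a Cauchy name of `y ≥ 0`, not a dyadic rational, to the name of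
`realCode y`. -/
noncomputable def realCodeFun : (ℕ → ℕ) →. (ℕ → ℕ) := fun s =>
  ⟨∃ y, Representation.real.Names s y ∧ 0 ≤ y ∧ ∀ n j : ℕ, 2 ^ n * y ≠ j,
    fun h => Representation.natBits (realCode h.choose)⟩

theorem mem_realCodeFun {s : ℕ → ℕ} {y : ℝ} (hs : Representation.real.Names s y) (hy : 0 ≤ y)
    (hd : ∀ n j : ℕ, 2 ^ n * y ≠ j) : Representation.natBits (realCode y) ∈ realCodeFun s := by
  have h : ∃ y, Representation.real.Names s y ∧ 0 ≤ y ∧ ∀ n j : ℕ, 2 ^ n * y ≠ j :=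
    ⟨y, hs, hy, hd⟩
  refine ⟨h, ?_⟩
  show Representation.natBits (realCode h.choose) = _
  rw [Representation.real.unique h.choose_spec.1 hs]

theorem computableFun_realCodeFun : ComputableFun realCodeFun := by
  refine computableFun_of_step (g := fun v n => if v.length = 0 then none else
    codeEntry (v[v.length - 1]?.getD 0) (v.length - 1) n) (Primrec.to_comp (by fun_prop)) ?_
  rintro s q ⟨h, rfl⟩
  obtain ⟨hs, hy, hd⟩ := h.choose_spec
  refine ⟨fun m n a ha => ?_, fun n => ?_⟩
  · rcases m with _ | m
    · simp at ha
    · simp only [length_pre, Nat.add_eq_zero_iff, one_ne_zero, and_false, if_false,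
        Nat.add_sub_cancel, getElem?_pre s (Nat.lt_succ_self m), Option.getD_some] at ha
      exact codeEntry_eq_some hy (hs m) ha
  · obtain ⟨m₀, hm₀⟩ := codeEntry_ne_none hs hy hd n
    refine ⟨m₀ + 1, fun m hm => ?_⟩
    rcases m with _ | m
    · omega
    · simp only [length_pre, Nat.add_eq_zero_iff, one_ne_zero, and_false, if_false,
        Nat.add_sub_cancel, getElem?_pre s (Nat.lt_succ_self m), Option.getD_some]
      exact hm₀ m (by omega)

/-! ### Real numbers bounded away from the dyadic rationals -/

/-- The positive real numbers whose distance from `j / 2 ^ n` is at least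
`4 ^ (-n) / (1 + y)`. -/
def AwayFromDyadics (y : ℝ) : Prop :=
  0 < y ∧ ∀ n j : ℕ, 1 ≤ (1 + y) * |2 ^ n * y - j| * 2 ^ n

theorem AwayFromDyadics.ne {y : ℝ} (h : AwayFromDyadics y) (n j : ℕ) : 2 ^ n * y ≠ j := by
  intro he
  have := h.2 n j
  rw [he] at this
  norm_num at this

theorem exists_of_not_awayFromDyadics {y : ℝ} (hy : 0 ≤ y) (h : ¬ AwayFromDyadics y) :
    ∃ n j : ℕ, (1 + y) * |2 ^ n * y - j| * 2 ^ n < 1 := by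
  rcases hy.eq_or_lt with rfl | hy
  · exact ⟨0, 0, by simp⟩
  · by_contra! hc
    exact h ⟨hy, hc⟩

/-- The bounds for `y` show that `y` is too close to `j / 2 ^ n`. -/
def Near (c m n j : ℕ) : Prop :=
  (den c m + hi c m) * (2 ^ n * hi c m - j * den c m) * 2 ^ n < den c m * den c m ∧
  (den c m + hi c m) * (j * den c m - 2 ^ n * lo c m) * 2 ^ n < den c m * den c m

@[fun_prop] theorem primrecPred_near :
    PrimrecPred fun z : ℕ × ℕ × ℕ × ℕ => Near z.1 z.2.1 z.2.2.1 z.2.2.2 := by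
  unfold Near; fun_prop

theorem mul_tsub_mul_lt_iff {a b x y d : ℕ} (hd : 0 < d) :
    x * (a - b) * y < d ↔ (x : ℝ) * ((a : ℝ) - b) * y < d := by
  have hd' : (0 : ℝ) < d := by exact_mod_cast hd
  rw [← Nat.cast_lt (α := ℝ)]
  push_cast
  rw [natCast_tsub]
  rcases le_total ((a : ℝ) - b) 0 with h | h
  · rw [max_eq_right h]
    have h2 : (x : ℝ) * ((a : ℝ) - b) * y ≤ 0 :=
      mul_nonpos_of_nonpos_of_nonneg (mul_nonpos_of_nonneg_of_nonpos (by positivity) h)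
        (by positivity)
    simp only [mul_zero, zero_mul]
    exact ⟨fun _ => h2.trans_lt hd', fun _ => hd'⟩
  · rw [max_eq_left h]

theorem near_iff {c m n j : ℕ} : Near c m n j ↔
    (1 + (hi c m : ℝ) / den c m) * (2 ^ n * ((hi c m : ℝ) / den c m) - j) * 2 ^ n < 1 ∧
    (1 + (hi c m : ℝ) / den c m) * (j - 2 ^ n * ((lo c m : ℝ) / den c m)) * 2 ^ n < 1 := by
  have hd := den_pos c m
  have hd' : (0 : ℝ) < den c m := by exact_mod_cast hd
  have hdd : (0 : ℝ) < den c m * den c m := by positivity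
  rw [Near, mul_tsub_mul_lt_iff (by positivity), mul_tsub_mul_lt_iff (by positivity)]
  push_cast
  refine and_congr ?_ ?_
  · rw [← div_lt_one hdd]
    refine iff_of_eq (congrArg (· < 1) ?_)
    field_simp
  · rw [← div_lt_one hdd]
    refine iff_of_eq (congrArg (· < 1) ?_)
    field_simp

theorem not_awayFromDyadics_of_near {c m n j : ℕ} {y : ℝ}
    (h : |(Representation.ratOf c : ℝ) - y| ≤ (1 / 2) ^ m) (hn : Near c m n j) :
    ¬ AwayFromDyadics y := by
  rintro ⟨hy, ha⟩
  obtain ⟨h1, h2⟩ := near_iff.1 hn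
  have hl := lo_div_den_le hy.le h
  have hh := le_hi_div_den h
  set l := (lo c m : ℝ) / den c m
  set t := (hi c m : ℝ) / den c m
  have hn := ha n j
  have hpow : (0 : ℝ) < 2 ^ n := by positivity
  rcases abs_cases (2 ^ n * y - (j : ℝ)) with ⟨he, hs⟩ | ⟨he, hs⟩
  · rw [he] at hn
    have : (1 + y) * (2 ^ n * y - j) * 2 ^ n ≤ (1 + t) * (2 ^ n * t - j) * 2 ^ n := by gcongr
    linarith
  · rw [he] at hn
    have h3 : (1 + y) * -(2 ^ n * y - j) * 2 ^ n ≤ (1 + t) * (j - 2 ^ n * l) * 2 ^ n := by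
      have h4 : -(2 ^ n * y - j) ≤ j - 2 ^ n * l := by
        have : 2 ^ n * l ≤ 2 ^ n * y := by gcongr
        linarith
      have h5 : 0 ≤ -(2 ^ n * y - (j : ℝ)) := by linarith
      gcongr
    linarith

theorem exists_near {s : ℕ → ℕ} {y : ℝ} (hs : Representation.real.Names s y) (hy : 0 ≤ y)
    {n j : ℕ} (h : (1 + y) * |2 ^ n * y - j| * 2 ^ n < 1) :
    ∃ m₀, ∀ m, m₀ ≤ m → Near (s m) m n j := by
  have hmax : max y 0 = y := max_eq_left hy
  have hlo := tendsto_lo_div_den hs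
  have hhi := tendsto_hi_div_den hs
  rw [hmax] at hlo hhi
  have l1 := ((hhi.const_add 1).mul ((hhi.const_mul (2 ^ n)).sub_const (j : ℝ))).mul_const
    ((2 : ℝ) ^ n)
  have l2 := ((hhi.const_add 1).mul ((hlo.const_mul (2 ^ n)).const_sub (j : ℝ))).mul_const
    ((2 : ℝ) ^ n)
  have b1 : (1 + y) * (2 ^ n * y - j) * 2 ^ n < 1 := by
    refine lt_of_le_of_lt ?_ h
    gcongr
    exact le_abs_self _
  have b2 : (1 + y) * (j - 2 ^ n * y) * 2 ^ n < 1 := by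
    refine lt_of_le_of_lt ?_ h
    gcongr
    rw [abs_sub_comm]
    exact le_abs_self _
  obtain ⟨m₀, hm₀⟩ := eventually_atTop.1
    ((l1.eventually_lt_const b1).and (l2.eventually_lt_const b2))
  exact ⟨m₀, fun m hm => near_iff.2 (hm₀ m hm)⟩

/-! ### From `ℕ × 2^ℕ` to real numbers -/

/-- A prefix `u` of a Cauchy name of `y` shows that `y` is not a positive real number away from
the dyadic rationals, or `v` rejects a prefix of `realCode y`. -/
def RefutedReal (v u : List ℕ) : Prop :=
  ∃ m, m < u.length ∧ (hi (u[m]?.getD 0) m = 0 ∨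
    (∃ n, n < u.length ∧ ∃ j, j < u.length ∧ Near (u[m]?.getD 0) m n j) ∨
    ∃ l, l < u.length + 1 ∧ (¬ ∃ n, n < l ∧ codeEntry (u[m]?.getD 0) m n = none) ∧
      Representation.Rejects v
        ((List.range l).map fun n => (codeEntry (u[m]?.getD 0) m n).getD 0))

theorem primrecPred_refutedReal :
    PrimrecPred fun z : List ℕ × List ℕ => RefutedReal z.1 z.2 := by
  unfold RefutedReal; fun_prop

theorem refutedReal_iff {p s : ℕ → ℕ} {y : ℝ} {B : Set (ℕ × (ℕ → Bool))}
    (hp : Representation.FunNames Representation.natCantor Representation.sierpinski p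
      (Representation.coChar B)) (hs : Representation.real.Names s y) :
    ¬ (AwayFromDyadics y ∧ realCode y ∈ B) ↔ ∃ n, RefutedReal (pre p n) (pre s n) := by
  have hc : ∀ {m n}, m < n → (pre s n)[m]?.getD 0 = s m := fun h => by
    rw [getElem?_pre s h]; rfl
  constructor
  · intro h
    rcases lt_or_ge y 0 with hy | hy
    · have hev : ∀ᶠ m in atTop, (Representation.ratOf (s m) : ℝ) + (1 / 2) ^ m < 0 := by
        have h0 : Tendsto (fun m : ℕ => ((1 : ℝ) / 2) ^ m) atTop (𝓝 0) :=
          tendsto_pow_atTop_nhds_zero_of_lt_one (by norm_num) (by norm_num)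
        have := (tendsto_ratOf hs).add h0
        rw [add_zero] at this
        exact this.eventually_lt_const hy
      obtain ⟨m, hm⟩ := hev.exists
      refine ⟨m + 1, m, by simp, Or.inl ?_⟩
      rw [hc (Nat.lt_succ_self m)]
      have h1 := hi_div_den (s m) m
      rw [max_eq_right hm.le, div_eq_zero_iff] at h1
      rcases h1 with h1 | h1
      · exact_mod_cast h1
      · exact absurd h1 (by exact_mod_cast (den_pos _ _).ne')
    · by_cases hF : AwayFromDyadics y
      · have hB : realCode y ∉ B := fun hB => h ⟨hF, hB⟩
        obtain ⟨T, hT⟩ := Representation.rejects_of_not_mem hp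
          (show Representation.natCantor.Names (Representation.natBits (realCode y)) _ from rfl) hB
        choose f hf using codeEntry_ne_none hs hy hF.ne
        set m := (Finset.range T).sup f with hm
        have hne : ∀ n < T, codeEntry (s m) m n ≠ none := fun n hn =>
          hf n m (Finset.le_sup (Finset.mem_range.2 hn))
        refine ⟨max (m + 1) T, m, by simp, Or.inr (Or.inr ⟨T, by simp, ?_, ?_⟩)⟩
        · rw [hc (by omega)]
          rintro ⟨n, hn, h0⟩
          exact hne n hn h0
        · rw [hc (by omega)]
          have hw : ((List.range T).map fun n => (codeEntry (s m) m n).getD 0) =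
              pre (Representation.natBits (realCode y)) T := by
            refine List.map_congr_left fun n hn => ?_
            obtain ⟨a, ha⟩ := Option.ne_none_iff_exists'.1 (hne n (List.mem_range.1 hn))
            rw [ha, codeEntry_eq_some hy (hs m) ha]
            rfl
          rw [hw]
          exact hT _ _ (le_max_right _ _) le_rfl
      · obtain ⟨n, j, hnj⟩ := exists_of_not_awayFromDyadics hy hF
        obtain ⟨m, hm⟩ := exists_near hs hy hnj
        refine ⟨m + n + j + 1, m, by rw [length_pre]; omega, Or.inr (Or.inl
          ⟨n, by rw [length_pre]; omega, j, by rw [length_pre]; omega, ?_⟩)⟩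
        rw [hc (by omega)]
        exact hm m le_rfl
  · rintro ⟨N, m, hm, hr⟩ ⟨hF, hB⟩
    rw [length_pre] at hm
    rw [hc hm] at hr
    rcases hr with h0 | ⟨n, -, j, -, hn⟩ | ⟨l, -, hne, hr⟩
    · have := le_hi_div_den (hs m)
      rw [h0, Nat.cast_zero, zero_div] at this
      exact absurd hF.1 (not_lt.2 this)
    · exact not_awayFromDyadics_of_near (hs m) hn hF
    · have hw : ((List.range l).map fun n => (codeEntry (s m) m n).getD 0) =
          pre (Representation.natBits (realCode y)) l := by
        refine List.map_congr_left fun n hn => ?_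
        obtain ⟨a, ha⟩ := Option.ne_none_iff_exists'.1
          (fun h0 => hne ⟨n, List.mem_range.1 hn, h0⟩ : codeEntry (s m) m n ≠ none)
        rw [ha, codeEntry_eq_some hF.1.le (hs m) ha]
        rfl
      rw [hw] at hr
      exact Representation.not_mem_of_rejects hp
        (show Representation.natCantor.Names (Representation.natBits (realCode y)) _ from rfl)
        hr hB

theorem realCode_add_binReal {k l : ℕ} {x : ℕ → Bool}
    (h : AwayFromDyadics (Nat.pair k l + binReal x)) :
    realCode (Nat.pair k l + binReal x) = (k, x) := by
  have hfl : ∀ n, ⌊(2 : ℝ) ^ n * (Nat.pair k l + binReal x)⌋₊ =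
      2 ^ n * Nat.pair k l + binVal x n := by
    intro n
    have h1 := binVal_le_mul_binReal x n
    have h2 := mul_binReal_le_binVal_add_one x n
    have h3 := h.ne n (2 ^ n * Nat.pair k l + binVal x n + 1)
    rw [Nat.floor_eq_iff (mul_nonneg (by positivity) h.1.le)]
    push_cast at h3 ⊢
    refine ⟨by linarith, lt_of_le_of_ne (by linarith) h3⟩
  refine Prod.ext ?_ (funext fun i => ?_)
  · have := hfl 0
    simp only [pow_zero, one_mul, binVal, add_zero] at this
    simp only [realCode, this, Nat.unpair_pair]
  · simp only [realCode, hfl, binVal]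
    have e : 2 ^ (i + 1) * Nat.pair k l + (2 * binVal x i + (x i).toNat) =
        (x i).toNat + 2 * (2 ^ i * Nat.pair k l + binVal x i) := by ring
    rw [e, Nat.add_mul_mod_self_left]
    cases x i <;> simp

theorem cantorMeasure_not_awayFromDyadics_le (N : ℕ) :
    cantorMeasure {x | ¬ AwayFromDyadics (N + binReal x)} ≤ ENNReal.ofReal (8 / (N + 1)) := by
  set S : ℕ → Set ℝ := fun n => ⋃ i ∈ Finset.range (2 ^ n + 1),
    Metric.ball ((i : ℝ) / 2 ^ n) (1 / ((N + 1) * 2 ^ n * 2 ^ n)) with hS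
  have hsub : {x | ¬ AwayFromDyadics (N + binReal x)} ⊆ binReal ⁻¹' ⋃ n, S n := by
    intro x hx
    have h0 := binReal_nonneg x
    have h1 := binReal_le_one x
    obtain ⟨n, j, hnj⟩ := exists_of_not_awayFromDyadics
      (add_nonneg (Nat.cast_nonneg N) h0) hx
    have hpow : (1 : ℝ) ≤ 2 ^ n := one_le_pow₀ (by norm_num)
    set t := binReal x with ht
    have hle : ((N : ℝ) + 1) * |2 ^ n * (N + t) - j| * 2 ^ n < 1 := by
      have hN : (N : ℝ) + 1 ≤ 1 + (N + t) := by linarith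
      refine lt_of_le_of_lt ?_ hnj
      gcongr
    set i : ℤ := (j : ℤ) - 2 ^ n * N with hi'
    have hij : 2 ^ n * ((N : ℝ) + t) - j = 2 ^ n * t - i := by
      rw [hi']; push_cast; ring
    rw [hij] at hle
    have hlt1 : |2 ^ n * t - (i : ℝ)| < 1 := by
      by_contra! hc
      have hN : (1 : ℝ) ≤ (N : ℝ) + 1 := by linarith [(Nat.cast_nonneg N : (0 : ℝ) ≤ N)]
      have : (1 : ℝ) ≤ ((N : ℝ) + 1) * |2 ^ n * t - i| * 2 ^ n :=
        one_le_mul_of_one_le_of_one_le (one_le_mul_of_one_le_of_one_le hN hc) hpow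
      linarith
    rw [abs_lt] at hlt1
    have hi0 : 0 ≤ i := by
      have : (-1 : ℝ) < i := by nlinarith [hlt1.2]
      have : (-1 : ℤ) < i := by exact_mod_cast this
      omega
    have hi1 : i ≤ 2 ^ n := by
      have : (i : ℝ) < 2 ^ n + 1 := by nlinarith [hlt1.1]
      have : i < 2 ^ n + 1 := by exact_mod_cast this
      omega
    clear_value i
    obtain ⟨a, rfl⟩ : ∃ a : ℕ, i = a := ⟨i.toNat, by omega⟩
    have ha : a < 2 ^ n + 1 := by
      have : (a : ℤ) < ((2 ^ n + 1 : ℕ) : ℤ) := by push_cast; omega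
      exact_mod_cast this
    refine Set.mem_iUnion.2 ⟨n, Set.mem_biUnion (Finset.mem_coe.2 (Finset.mem_range.2 ha)) ?_⟩
    rw [Metric.mem_ball, Real.dist_eq]
    have hpos : (0 : ℝ) < 2 ^ n := by linarith
    have e : t - (a : ℝ) / 2 ^ n = (2 ^ n * t - a) / 2 ^ n := by field_simp
    rw [e, abs_div, abs_of_pos hpos, div_lt_div_iff₀ hpos (by positivity)]
    push_cast at hle
    nlinarith
  have hball : ∀ n, volume (S n) ≤ ENNReal.ofReal (4 / (N + 1) * (1 / 2) ^ n) := by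
    intro n
    refine (measure_biUnion_finset_le _ _).trans ?_
    simp only [Real.volume_ball, Finset.sum_const, Finset.card_range, nsmul_eq_mul]
    rw [← ENNReal.ofReal_natCast, ← ENNReal.ofReal_mul (by positivity)]
    refine ENNReal.ofReal_le_ofReal ?_
    push_cast
    have hpow : (1 : ℝ) ≤ 2 ^ n := one_le_pow₀ (by norm_num)
    have hpos : (0 : ℝ) < 2 ^ n := by linarith
    rw [div_pow, one_pow]
    have e : ((2 : ℝ) ^ n + 1) * (2 * (1 / ((N + 1) * 2 ^ n * 2 ^ n))) =
        (2 * (2 ^ n + 1)) / ((N + 1) * 2 ^ n * 2 ^ n) := by field_simp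
    have e' : (4 : ℝ) / (N + 1) * (1 / 2 ^ n) = (4 * 2 ^ n) / ((N + 1) * 2 ^ n * 2 ^ n) := by
      field_simp
    rw [e, e']
    exact div_le_div_of_nonneg_right (by linarith) (by positivity)
  calc cantorMeasure {x | ¬ AwayFromDyadics (N + binReal x)}
      ≤ cantorMeasure (binReal ⁻¹' ⋃ n, S n) := measure_mono hsub
    _ ≤ cantorMeasure.map binReal (⋃ n, S n) :=
        Measure.le_map_apply measurable_binReal.aemeasurable _
    _ ≤ volume (⋃ n, S n) := by rw [map_binReal]; exact Measure.restrict_apply_le _ _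
    _ ≤ ∑' n, volume (S n) := measure_iUnion_le _
    _ ≤ ∑' n, ENNReal.ofReal (4 / (N + 1) * (1 / 2) ^ n) := ENNReal.tsum_le_tsum hball
    _ = ENNReal.ofReal (∑' n : ℕ, 4 / ((N : ℝ) + 1) * (1 / 2) ^ n) :=
        (ENNReal.ofReal_tsum_of_nonneg (fun n => by positivity)
          (summable_geometric_two.mul_left _)).symm
    _ = ENNReal.ofReal (8 / (N + 1)) := by
        rw [tsum_mul_left, tsum_geometric_two]
        congr 1
        ring

theorem volume_awayFromDyadics_pos {B : Set (ℕ × (ℕ → Bool))} (hB : 0 < natCantorMeasure B)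
    (hA : MeasurableSet {y | AwayFromDyadics y ∧ realCode y ∈ B}) :
    0 < volume {y | AwayFromDyadics y ∧ realCode y ∈ B} := by
  obtain ⟨k, hk⟩ := exists_section_pos hB
  by_contra! h0
  have hA0 := nonpos_iff_eq_zero.1 h0
  have hle : ∀ l : ℕ, cantorMeasure {x | (k, x) ∈ B} ≤ ENNReal.ofReal (8 / (l + 1)) := by
    intro l
    have hz : cantorMeasure {x | (Nat.pair k l : ℝ) + binReal x ∈
        {y | AwayFromDyadics y ∧ realCode y ∈ B}} = 0 := by
      rw [cantorMeasure_add_binReal hA]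
      exact measure_mono_null Set.inter_subset_left hA0
    have hsub : {x | (k, x) ∈ B} ⊆ {x | (Nat.pair k l : ℝ) + binReal x ∈
        {y | AwayFromDyadics y ∧ realCode y ∈ B}} ∪
        {x | ¬ AwayFromDyadics ((Nat.pair k l : ℕ) + binReal x)} := by
      intro x hx
      by_cases hF : AwayFromDyadics ((Nat.pair k l : ℕ) + binReal x)
      · refine Or.inl ⟨hF, ?_⟩
        rw [realCode_add_binReal hF]
        exact hx
      · exact Or.inr hF
    refine (measure_mono hsub).trans ((measure_union_le _ _).trans ?_)
    rw [hz, zero_add]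
    refine (cantorMeasure_not_awayFromDyadics_le _).trans (ENNReal.ofReal_le_ofReal ?_)
    have : (l : ℝ) ≤ Nat.pair k l := by exact_mod_cast Nat.right_le_pair k l
    gcongr
  have hlim : Tendsto (fun l : ℕ => ENNReal.ofReal (8 / ((l : ℝ) + 1))) atTop (𝓝 0) := by
    have h := (tendsto_one_div_add_atTop_nhds_zero_nat (𝕜 := ℝ)).const_mul 8
    simp only [mul_one_div, mul_zero] at h
    simpa using ENNReal.tendsto_ofReal h
  exact hk.ne' (nonpos_iff_eq_zero.1 (ge_of_tendsto' hlim hle))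

theorem pcNatCantor_le_pcReal : LeSW PCNatCantor PCReal := by
  classical
  refine leSW_of_total (computableFun_associate (E := fun v u => decide (RefutedReal v u))
    primrecPred_refutedReal.decide.to_comp) computableFun_realCodeFun ?_
  intro p B hp hB
  have hp' : Representation.FunNames Representation.natCantor Representation.sierpinski p
    (Representation.coChar B.1) := hp
  have hname : Representation.FunNames Representation.real Representation.sierpinski
      (associate (fun v u => decide (RefutedReal v u)) p)
      (Representation.coChar {y | AwayFromDyadics y ∧ realCode y ∈ B.1}) := by
    refine Representation.funNames_associate fun s y hs => ?_
    simp only [decide_eq_true_eq]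
    exact refutedReal_iff hp' hs
  have hBpos : 0 < natCantorMeasure B.1 := mem_dom_posChoice.1 hB
  have hpos := volume_awayFromDyadics_pos hBpos (isClosed_of_real_funNames hname).measurableSet
  refine ⟨⟨_, Representation.isClosed_of_funNames hname⟩, hname, mem_dom_posChoice.2 hpos, ?_⟩
  rintro s y ⟨⟨hF, hy⟩, -⟩ hs
  exact ⟨_, mem_realCodeFun hs hF.1.le hF.ne, realCode y, ⟨hy, hBpos, le_top⟩, rfl⟩

theorem equivSW_of_cycle {f g h k : MultiFun.{u, v}} (hfg : LeSW f g) (hgk : LeSW g k)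
    (hkf : LeSW k f) (hhk : LeSW h k) (hkh : LeSW k h) :
    EquivSW f g ∧ EquivSW g h ∧ EquivSW h k :=
  ⟨⟨hfg, hgk.trans hkf⟩, ⟨hgk.trans hkh, hhk.trans (hkf.trans hfg)⟩, ⟨hhk, hkh⟩⟩

end MultiFun

end Weihrauch

theorem theorem8p1 :
    (Weihrauch.MultiFun.EquivSW Weihrauch.MultiFun.WWKL.discreteJump
        Weihrauch.MultiFun.PCCantor.discreteJump ∧
      Weihrauch.MultiFun.EquivSW Weihrauch.MultiFun.PCCantor.discreteJump
        Weihrauch.MultiFun.PCReal ∧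
      Weihrauch.MultiFun.EquivSW Weihrauch.MultiFun.PCReal Weihrauch.MultiFun.PCNatCantor) ∧
    ∀ f : Weihrauch.MultiFun.{u, v},
      Weihrauch.MultiFun.LasVegasFMC f ↔
        Weihrauch.MultiFun.LeW f Weihrauch.MultiFun.WWKL.discreteJump := by
  open Weihrauch.MultiFun in
  exact ⟨equivSW_of_cycle wwkl_jump_le pcCantor_jump_le pcNatCantor_le pcReal_le
      pcNatCantor_le_pcReal,
    fun f => ⟨fun hf => hf.leW.trans_leSW pcNatCantor_le,
      fun hf => lasVegasFMC_of_leW (hf.trans_leSW (wwkl_jump_le.trans pcCantor_jump_le))⟩⟩
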